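/- For a frame $U=(u_1,\dots,u_n)$ of vectors in $\mathbb{R}^d$, let $s(U)=\sum_{i=1}^n\|u_i\|_2^2$. For $\epsilon\ge 0$, $U$ is called $\epsilon$-nearly doubly balanced if, in the Loewner order, $$(1-\epsilon)\tfrac{s(U)}{d}I_d\preceq\sum_{i=1}^n u_iu_i^{*}\preceq(1+\epsilon)\tfrac{s(U)}{d}I_d\quad\text{and}\quad(1-\epsilon)\tfrac{s(U)}{n}I_n\preceq\operatorname{diag}\big(\|u_1\|_2^2,\dots,\|u_n\|_2^2\big)\preceq(1+\epsilon)\tfrac{s(U)}{n}I_n .$$ $U$ satisfies the $\lambda$-spectral gap condition if $\lambda_2(G)\le(1-\lambda)^2\,\frac{s(U)^2}{dn}$, where $G\in\mathbb{R}^{n\times n}$ has entries $G_{ij}=\langle u_i,u_j\rangle^2$ and $\lambda_2(G)$ is its second largest eigenvalue, counted with multiplicity (and $0$ if $n=1$). If all $u_i$ are unit vectors, then $s(U)=n$ and the condition reads $\lambda_2(G)\le(1-\lambda)^2\,n/d$. **Theorem.** Let $u_1,\dots,u_n$ be independent, uniformly distributed random unit vectors in $\mathbb{R}^d$, and let $U=(u_1,\dots,u_n)$.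 (i) There is a sequence $\epsilon_d\ge 0$ with $\epsilon_d=o(1/\log d)$, that is $\epsilon_d\log d\to 0$ as $d\to\infty$, such that for every constant $\lambda\in[0,1)$ there are constants $C>0$ and $D$, depending only on $\lambda$, for which the following holds: for all $d\ge D$ and all $n\ge C\,d^{4/3}$, with probability at least $0.99$, the frame $U$ is $\epsilon_d$-nearly doubly balanced and $\lambda_2(G)\le(1-\lambda)^2\,n/d$. (ii) There is an absolute constant $\lambda\in(0,1)$ such that for every $c>0$ there is a constant $C>0$, depending only on $c$, for which the following holds: for all $d\ge 1$ and all $n\ge C\,d^{4/3}$ there is $\epsilon\ge 0$ with $\epsilon\log d\le c$ such that, with probability at least $0.99$, the frame $U$ is $\epsilon$-nearly doubly balanced and $\lambda_2(G)\le(1-\lambda)^2\,n/d$. -/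

import Mathlib

open MeasureTheory Filter Topology

/-- The size `s(U) = ∑ ‖u_i‖²` of a frame `U = (u_1, …, u_n)` in `ℝ^d`. -/
noncomputable def frameSize {d n : ℕ} (u : Fin n → EuclideanSpace ℝ (Fin d)) : ℝ :=
  ∑ i, ‖u i‖ ^ 2

/-- The frame matrix `∑ u_i u_iᵀ`. -/
noncomputable def frameMatrix {d n : ℕ} (u : Fin n → EuclideanSpace ℝ (Fin d)) :
    Matrix (Fin d) (Fin d) ℝ :=
  ∑ i, Matrix.vecMulVec (fun a => u i a) (fun a => u i a)

/-- The diagonal matrix of the squared norms of the vectors of a frame. -/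
noncomputable def frameNormMatrix {d n : ℕ} (u : Fin n → EuclideanSpace ℝ (Fin d)) :
    Matrix (Fin n) (Fin n) ℝ :=
  Matrix.diagonal (fun i => ‖u i‖ ^ 2)

/-- `ε`-nearly doubly balanced frames:
`(1-ε) s/d I_d ≼ ∑ u_i u_iᵀ ≼ (1+ε) s/d I_d` and
`(1-ε) s/n I_n ≼ diag(‖u_i‖²) ≼ (1+ε) s/n I_n` in the Loewner order. -/
def NearlyDoublyBalanced {d n : ℕ} (ε : ℝ) (u : Fin n → EuclideanSpace ℝ (Fin d)) : Prop :=
  (frameMatrix u - ((1 - ε) * (frameSize u / d)) • (1 : Matrix (Fin d) (Fin d) ℝ)).PosSemidef ∧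
  (((1 + ε) * (frameSize u / d)) • (1 : Matrix (Fin d) (Fin d) ℝ) - frameMatrix u).PosSemidef ∧
  (frameNormMatrix u
    - ((1 - ε) * (frameSize u / n)) • (1 : Matrix (Fin n) (Fin n) ℝ)).PosSemidef ∧
  (((1 + ε) * (frameSize u / n)) • (1 : Matrix (Fin n) (Fin n) ℝ)
    - frameNormMatrix u).PosSemidef

/-- The entrywise squared Gram matrix `G_ij = ⟨u_i, u_j⟩²`. -/
noncomputable def sqGram {d n : ℕ} (u : Fin n → EuclideanSpace ℝ (Fin d)) :
    Matrix (Fin n) (Fin n) ℝ :=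
  Matrix.of fun i j => inner ℝ (u i) (u j) ^ 2

theorem sqGram_isHermitian {d n : ℕ} (u : Fin n → EuclideanSpace ℝ (Fin d)) :
    (sqGram u).IsHermitian := by
  ext i j
  simp [sqGram, real_inner_comm]

/-- The second largest eigenvalue, with multiplicity, of a Hermitian matrix (`eigenvalues₀` lists
the eigenvalues in decreasing order). A matrix of size below two has none; the value is then `0`. -/
noncomputable def secondEigenvalue {n : ℕ} {A : Matrix (Fin n) (Fin n) ℝ}
    (hA : A.IsHermitian) : ℝ :=
  if h : 1 < n then hA.eigenvalues₀ ⟨1, by simpa using h⟩ else 0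

/-- The `lam`-spectral gap condition for frames: `λ₂(G) ≤ (1 - lam)² s² / (d n)`. -/
def HasFrameSpectralGap {d n : ℕ} (lam : ℝ) (u : Fin n → EuclideanSpace ℝ (Fin d)) : Prop :=
  secondEigenvalue (sqGram_isHermitian u) ≤ (1 - lam) ^ 2 * (frameSize u ^ 2 / (d * n))

/-- The uniform probability measure on the unit sphere of `ℝ^d` (for `d ≥ 1`): the surface
measure divided by its total mass. -/
noncomputable def sphereUniform (d : ℕ) :
    Measure (Metric.sphere (0 : EuclideanSpace ℝ (Fin d)) 1) :=
  ((volume : Measure (EuclideanSpace ℝ (Fin d))).toSphere Set.univ)⁻¹ •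
    (volume : Measure (EuclideanSpace ℝ (Fin d))).toSphere

/-- The law of `n` independent uniformly random unit vectors in `ℝ^d`. -/
noncomputable def randomUnitVectors (d n : ℕ) :
    Measure (Fin n → Metric.sphere (0 : EuclideanSpace ℝ (Fin d)) 1) :=
  Measure.pi fun _ => sphereUniform d

/-- The event that a tuple of unit vectors, as a frame in `ℝ^d`, is `ε`-nearly doubly balanced
and satisfies the `lam`-spectral gap condition. -/
def goodFrames (d n : ℕ) (ε lam : ℝ) :
    Set (Fin n → Metric.sphere (0 : EuclideanSpace ℝ (Fin d)) 1) :=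
  {u | NearlyDoublyBalanced ε (fun i => (u i : EuclideanSpace ℝ (Fin d))) ∧
    HasFrameSpectralGap lam (fun i => (u i : EuclideanSpace ℝ (Fin d)))}

/-!
Near-balance amounts to a uniform bound on the quadratic form `Q(v) = ∑ (d ⟨u_i, v⟩² - ‖v‖²)` over
unit vectors `v`. Polar coordinates give `∫ ‖A u‖^(-d) = 1 / |det A|` on the sphere; with `A` a
stretching along `v` this bounds the exponential moments of `d ⟨u, v⟩²`, and Chernoff's inequality
controls `Q(v)` for a fixed `v`. No net is needed to pass to all `v`: a quadratic form keeps half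
its maximal absolute value on a cap of radius `1/4`, whose measure is at least `16^(-d)`, so
Markov's inequality for the measure of large values of `Q` suffices.

For the spectral gap, the kernel `k(x, y) = ⟨x, y⟩² - 1/d` satisfies
`∫ k(x, z) k(z, y) dz = α k(x, y)` with `α = 2 / (d (d + 2))`, so its off-diagonal matrix `K` on the
sample satisfies `K² ≈ (n - 2) α K`. A second-moment bound on the Frobenius norm of the difference
bounds the quadratic form of `K`, and the squared Gram matrix agrees with `K + (1 - 1/d) I` on the
orthogonal complement of the all-ones vector, which is enough for `λ₂` by Courant–Fischer.
-/

open scoped InnerProductSpace Pointwise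

section PolarCoordinates

variable {E : Type*} [NormedAddCommGroup E] [NormedSpace ℝ E] [FiniteDimensional ℝ E]
  [MeasurableSpace E] [BorelSpace E] [Nontrivial E] (μ : Measure E) [μ.IsAddHaarMeasure]

theorem volumeIoiPow_setOf_mul_lt_one (n : ℕ) {a : ℝ} (ha : 0 < a) :
    Measure.volumeIoiPow n {r | (r : ℝ) * a < 1} =
      ENNReal.ofReal ((a ^ (n + 1))⁻¹) * ((n + 1 : ℕ) : ENNReal)⁻¹ := by
  have hset : {r : Set.Ioi (0 : ℝ) | (r : ℝ) * a < 1} = Set.Iio ⟨a⁻¹, inv_pos.2 ha⟩ := by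
    ext r
    exact (by rw [← one_div, lt_div_iff₀ ha] : (r : ℝ) < a⁻¹ ↔ r * a < 1).symm
  rw [hset, Measure.volumeIoiPow_apply_Iio, div_eq_mul_inv, ENNReal.ofReal_mul (by positivity),
    inv_pow, ENNReal.ofReal_inv_of_pos (by positivity), ENNReal.ofReal_inv_of_pos (by positivity),
    ← Nat.cast_add_one, ENNReal.ofReal_natCast]

theorem lintegral_toSphere_inv_pow_of_homogeneous {g : E → ℝ} (hg : Measurable g)
    (hsmul : ∀ r : ℝ, 0 < r → ∀ x, g (r • x) = r * g x)
    (hpos : ∀ u : Metric.sphere (0 : E) 1, 0 < g u) :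
    ∫⁻ u : Metric.sphere (0 : E) 1, ENNReal.ofReal ((g u ^ Module.finrank ℝ E)⁻¹) ∂μ.toSphere =
      Module.finrank ℝ E * μ {x | g x < 1} := by
  obtain ⟨n, hn⟩ := Nat.exists_eq_add_one.2 (Module.finrank_pos (R := ℝ) (M := E))
  have hmeas : MeasurableSet {p : Metric.sphere (0 : E) 1 × Set.Ioi (0 : ℝ) |
      (p.2 : ℝ) * g p.1 < 1} := by
    apply measurableSet_lt <;> fun_prop
  have hpolar : μ {x | g x < 1} =
      μ.toSphere.prod (Measure.volumeIoiPow n) {p | (p.2 : ℝ) * g p.1 < 1} := by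
    calc μ {x | g x < 1}
        = μ.comap (Subtype.val : ({0}ᶜ : Set E) → E) (Subtype.val ⁻¹' {x | g x < 1}) := by
          rw [comap_subtype_coe_apply (measurableSet_singleton _).compl,
            Subtype.image_preimage_coe, Set.inter_comm, ← Set.sdiff_eq,
            measure_sdiff_null (measure_singleton _)]
      _ = _ := by
          rw [← Nat.add_sub_cancel (n := n) (m := 1), ← hn,
            ← μ.measurePreserving_homeomorphUnitSphereProd.measure_preimage_emb
              (Homeomorph.measurableEmbedding _)]
          congr 1
          ext x
          have hx : 0 < ‖(x : E)‖ := norm_pos_iff.2 x.2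
          simp only [Set.mem_preimage, Set.mem_ofPred_eq,
            homeomorphUnitSphereProd_apply_snd_coe, homeomorphUnitSphereProd_apply_fst_coe]
          rw [hsmul _ (inv_pos.2 hx), mul_inv_cancel_left₀ hx.ne']
  have hslice : ∀ u : Metric.sphere (0 : E) 1,
      Measure.volumeIoiPow n (Prod.mk u ⁻¹' {p | (p.2 : ℝ) * g p.1 < 1}) =
        ENNReal.ofReal ((g u ^ (n + 1))⁻¹) * ((n + 1 : ℕ) : ENNReal)⁻¹ :=
    fun u => volumeIoiPow_setOf_mul_lt_one n (hpos u)
  rw [hpolar, Measure.prod_apply hmeas, hn]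
  simp_rw [hslice]
  rw [lintegral_mul_const _ (by fun_prop), mul_left_comm,
    ENNReal.mul_inv_cancel (by simp) (by simp), mul_one]

theorem lintegral_toSphere_inv_norm_map_pow {A : E →ₗ[ℝ] E} (hA : LinearMap.det A ≠ 0) :
    ∫⁻ u : Metric.sphere (0 : E) 1, ENNReal.ofReal ((‖A u‖ ^ Module.finrank ℝ E)⁻¹) ∂μ.toSphere =
      ENNReal.ofReal |(LinearMap.det A)⁻¹| * μ.toSphere Set.univ := by
  have hinj : Function.Injective A :=
    LinearMap.ker_eq_bot.1 <| (LinearMap.isUnit_iff_ker_eq_bot A).1 <|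
      (LinearMap.isUnit_iff_isUnit_det A).2 hA.isUnit
  have hball : {x | ‖A x‖ < 1} = A ⁻¹' Metric.ball 0 1 := by
    ext x
    rw [Set.mem_preimage, mem_ball_zero_iff, Set.mem_ofPred_eq]
  rw [lintegral_toSphere_inv_pow_of_homogeneous μ
      A.continuous_of_finiteDimensional.norm.measurable
      (fun r hr x => by rw [map_smul, norm_smul, Real.norm_of_nonneg hr.le])
      (fun u => norm_pos_iff.2 ((map_ne_zero_iff A hinj).2 (ne_zero_of_mem_unit_sphere u))),
    hball, Measure.addHaar_preimage_linearMap μ hA, μ.toSphere_apply_univ, mul_left_comm]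

end PolarCoordinates

section SphereIsometry

variable {E : Type*} [NormedAddCommGroup E] [InnerProductSpace ℝ E]

/-- The action of a linear isometry on the unit sphere. -/
def sphereMap (O : E ≃ₗᵢ[ℝ] E) (u : Metric.sphere (0 : E) 1) : Metric.sphere (0 : E) 1 :=
  ⟨O u, by rw [mem_sphere_zero_iff_norm, O.norm_map, norm_eq_of_mem_sphere]⟩

theorem continuous_sphereMap (O : E ≃ₗᵢ[ℝ] E) : Continuous (sphereMap O) :=
  (O.continuous.comp continuous_subtype_val).subtype_mk _

theorem injective_sphereMap (O : E ≃ₗᵢ[ℝ] E) : Function.Injective (sphereMap O) :=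
  fun _ _ h => Subtype.ext (O.injective (congrArg Subtype.val h))

theorem image_coe_preimage_sphereMap (O : E ≃ₗᵢ[ℝ] E) (s : Set (Metric.sphere (0 : E) 1)) :
    ((↑) '' (sphereMap O ⁻¹' s) : Set E) = O ⁻¹' ((↑) '' s) := by
  ext x
  constructor
  · rintro ⟨u, hu, rfl⟩
    exact ⟨sphereMap O u, hu, rfl⟩
  · rintro ⟨y, hy, hyx⟩
    have hx : x ∈ Metric.sphere (0 : E) 1 := by
      rw [mem_sphere_zero_iff_norm, ← O.norm_map, ← hyx, norm_eq_of_mem_sphere]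
    have hxy : sphereMap O ⟨x, hx⟩ = y := Subtype.ext hyx.symm
    exact ⟨⟨x, hx⟩, by rwa [Set.mem_preimage, hxy], rfl⟩

theorem measurePreserving_sphereMap [FiniteDimensional ℝ E] [MeasurableSpace E] [BorelSpace E]
    (O : E ≃ₗᵢ[ℝ] E) :
    MeasurePreserving (sphereMap O) (volume : Measure E).toSphere
      (volume : Measure E).toSphere := by
  refine ⟨(continuous_sphereMap O).measurable, ?_⟩
  ext s hs
  have hs' := (continuous_sphereMap O).measurable hs
  have hcone : Set.Ioo (0 : ℝ) 1 • (O ⁻¹' ((↑) '' s) : Set E) =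
      O ⁻¹' (Set.Ioo (0 : ℝ) 1 • ((↑) '' s : Set E)) := by
    rw [← O.symm_symm, ← O.symm.image_eq_preimage_symm, ← O.symm.image_eq_preimage_symm]
    exact (Set.image_image2_distrib_right fun r x => O.symm.map_smul r x).symm
  rw [Measure.map_apply (continuous_sphereMap O).measurable hs, Measure.toSphere_apply' _ hs,
    Measure.toSphere_apply' _ hs', image_coe_preimage_sphereMap, hcone,
    O.measurePreserving.measure_preimage_emb O.toHomeomorph.measurableEmbedding]

end SphereIsometry

theorem integrable_of_continuous_of_compactSpace {X : Type*} [TopologicalSpace X] [CompactSpace X]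
    [MeasurableSpace X] [OpensMeasurableSpace X] (μ : Measure X) [IsFiniteMeasure μ] {f : X → ℝ}
    (hf : Continuous f) : Integrable f μ :=
  hf.integrable_of_hasCompactSupport (HasCompactSupport.of_compactSpace f)

/-- The unit sphere of `ℝ^d`, as the type of the random vectors. -/
abbrev UnitSphere (d : ℕ) := Metric.sphere (0 : EuclideanSpace ℝ (Fin d)) 1

section SphereMoments

variable {d : ℕ}

instance [NeZero d] : IsProbabilityMeasure (sphereUniform d) where
  measure_univ := ENNReal.inv_mul_cancel
    (Measure.measure_univ_ne_zero.2 (Measure.toSphere_ne_zero _)) (measure_ne_top _ _)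

instance [NeZero d] (n : ℕ) : IsProbabilityMeasure (randomUnitVectors d n) := by
  unfold randomUnitVectors
  infer_instance

theorem sphereUniform_integral_comp_sphereMap
    (O : EuclideanSpace ℝ (Fin d) ≃ₗᵢ[ℝ] EuclideanSpace ℝ (Fin d)) (f : UnitSphere d → ℝ) :
    ∫ u, f (sphereMap O u) ∂sphereUniform d = ∫ u, f u ∂sphereUniform d :=
  ((measurePreserving_sphereMap O).smul_measure _).integral_comp
    ((continuous_sphereMap O).measurableEmbedding (injective_sphereMap O)) f

theorem sphereUniform_integral_comp_inner_eq_of_norm_eq (f : ℝ → ℝ)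
    {x y : EuclideanSpace ℝ (Fin d)} (h : ‖x‖ = ‖y‖) :
    ∫ u : UnitSphere d, f ⟪x, u⟫_ℝ ∂sphereUniform d =
      ∫ u : UnitSphere d, f ⟪y, u⟫_ℝ ∂sphereUniform d := by
  set R := Submodule.reflection (ℝ ∙ (x - y))ᗮ
  have hR : ∀ u : UnitSphere d, ⟪y, sphereMap R u⟫_ℝ = ⟪x, u⟫_ℝ := fun u => by
    rw [← R.inner_map_map x u, Submodule.reflection_sub h]
    rfl
  simpa only [hR] using
    sphereUniform_integral_comp_sphereMap R (fun u : UnitSphere d => f ⟪y, u⟫_ℝ)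

theorem sphereUniform_exists_integral_inner_pow [NeZero d] (p : ℕ) :
    ∃ c : ℝ, ∀ x : EuclideanSpace ℝ (Fin d),
      ∫ u : UnitSphere d, ⟪x, u⟫_ℝ ^ p ∂sphereUniform d = c * ‖x‖ ^ p := by
  set e : EuclideanSpace ℝ (Fin d) := EuclideanSpace.single 0 1
  have he : ‖e‖ = 1 := by simp [e]
  refine ⟨∫ u : UnitSphere d, ⟪e, u⟫_ℝ ^ p ∂sphereUniform d, fun x => ?_⟩
  rw [sphereUniform_integral_comp_inner_eq_of_norm_eq (fun t => t ^ p) (y := ‖x‖ • e)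
    (by rw [norm_smul, he, mul_one, norm_norm]), ← integral_mul_const]
  simp only [real_inner_smul_left, mul_pow, mul_comm]

theorem sphereUniform_sum_integral_mul_inner_basisFun_sq [NeZero d] {f : UnitSphere d → ℝ}
    (hf : Continuous f) :
    ∑ a, ∫ u, f u * ⟪EuclideanSpace.basisFun (Fin d) ℝ a, u⟫_ℝ ^ 2 ∂sphereUniform d =
      ∫ u, f u ∂sphereUniform d := by
  rw [← integral_finsetSum _ fun a _ =>
    integrable_of_continuous_of_compactSpace _ (by fun_prop)]
  refine integral_congr_ae (Eventually.of_forall fun u => ?_)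
  dsimp only
  rw [← Finset.mul_sum, OrthonormalBasis.sum_sq_inner_right, norm_eq_of_mem_sphere, one_pow,
    mul_one]

theorem sphereUniform_integral_inner_sq [NeZero d] (x : EuclideanSpace ℝ (Fin d)) :
    ∫ u : UnitSphere d, ⟪x, u⟫_ℝ ^ 2 ∂sphereUniform d = ‖x‖ ^ 2 / d := by
  obtain ⟨c, hc⟩ := sphereUniform_exists_integral_inner_pow (d := d) 2
  have hsum := sphereUniform_sum_integral_mul_inner_basisFun_sq (d := d) (f := fun _ => 1)
    continuous_const
  simp only [one_mul, hc, OrthonormalBasis.norm_eq_one, one_pow, mul_one, Finset.sum_const,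
    Finset.card_univ, Fintype.card_fin, nsmul_eq_mul, integral_const, probReal_univ,
    smul_eq_mul] at hsum
  rw [hc, eq_div_iff (NeZero.ne _)]
  linear_combination ‖x‖ ^ 2 * hsum

theorem sphereUniform_exists_integral_inner_sq_mul_inner_sq [NeZero d] :
    ∃ c : ℝ, ∀ x y : EuclideanSpace ℝ (Fin d),
      ∫ u : UnitSphere d, ⟪x, u⟫_ℝ ^ 2 * ⟪y, u⟫_ℝ ^ 2 ∂sphereUniform d =
        c * (‖x‖ ^ 2 * ‖y‖ ^ 2 + 2 * ⟪x, y⟫_ℝ ^ 2) := by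
  obtain ⟨c, hc⟩ := sphereUniform_exists_integral_inner_pow (d := d) 4
  refine ⟨c / 3, fun x y => ?_⟩
  have hpolarization : ∀ u : UnitSphere d, ⟪x, u⟫_ℝ ^ 2 * ⟪y, u⟫_ℝ ^ 2 =
      1 / 12 * ((⟪x + y, u⟫_ℝ ^ 4 + ⟪x - y, u⟫_ℝ ^ 4) -
        (2 * ⟪x, u⟫_ℝ ^ 4 + 2 * ⟪y, u⟫_ℝ ^ 4)) := fun u => by
    rw [inner_add_left, inner_sub_left]
    ring
  simp_rw [hpolarization]
  rw [integral_const_mul, integral_sub, integral_add, integral_add, integral_const_mul,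
    integral_const_mul, hc, hc, hc, hc]
  · have hadd : ‖x + y‖ ^ 4 = (‖x‖ ^ 2 + 2 * ⟪x, y⟫_ℝ + ‖y‖ ^ 2) ^ 2 := by
      rw [← norm_add_sq_real, ← pow_mul]
    have hsub : ‖x - y‖ ^ 4 = (‖x‖ ^ 2 - 2 * ⟪x, y⟫_ℝ + ‖y‖ ^ 2) ^ 2 := by
      rw [← norm_sub_sq_real, ← pow_mul]
    rw [hadd, hsub]
    ring
  all_goals exact integrable_of_continuous_of_compactSpace _ (by fun_prop)

theorem sphereUniform_integral_inner_sq_mul_inner_sq [NeZero d] (x y : EuclideanSpace ℝ (Fin d)) :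
    ∫ u : UnitSphere d, ⟪x, u⟫_ℝ ^ 2 * ⟪y, u⟫_ℝ ^ 2 ∂sphereUniform d =
      (‖x‖ ^ 2 * ‖y‖ ^ 2 + 2 * ⟪x, y⟫_ℝ ^ 2) / (d * (d + 2)) := by
  obtain ⟨c, hc⟩ := sphereUniform_exists_integral_inner_sq_mul_inner_sq (d := d)
  have hd : (d : ℝ) ≠ 0 := NeZero.ne _
  set e : EuclideanSpace ℝ (Fin d) := EuclideanSpace.single 0 1
  have he : ‖e‖ = 1 := by simp [e]
  have hsum := sphereUniform_sum_integral_mul_inner_basisFun_sq (d := d)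
    (f := fun u => ⟪e, u⟫_ℝ ^ 2) (by fun_prop)
  simp only [hc, ← Finset.mul_sum, Finset.sum_add_distrib, OrthonormalBasis.sum_sq_inner_left,
    OrthonormalBasis.norm_eq_one, sphereUniform_integral_inner_sq, he, one_pow, mul_one,
    Finset.sum_const, Finset.card_univ, Fintype.card_fin, nsmul_eq_mul] at hsum
  have hcd : c * (d * (d + 2)) = 1 := by
    rw [eq_div_iff hd] at hsum
    linear_combination hsum
  rw [hc, eq_div_iff (by positivity)]
  linear_combination (‖x‖ ^ 2 * ‖y‖ ^ 2 + 2 * ⟪x, y⟫_ℝ ^ 2) * hcd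

end SphereMoments

section MomentGeneratingFunction

/-- The linear map that scales the direction of a unit vector `v` by `r` and fixes `v^⊥`. -/
noncomputable def axisScaling {E : Type*} [NormedAddCommGroup E] [InnerProductSpace ℝ E]
    (v : E) (r : ℝ) : E →ₗ[ℝ] E :=
  LinearMap.transvection ((r - 1) • innerₗ E v) v

theorem det_axisScaling {E : Type*} [NormedAddCommGroup E] [InnerProductSpace ℝ E]
    [FiniteDimensional ℝ E] {v : E} (hv : ‖v‖ = 1) (r : ℝ) :
    LinearMap.det (axisScaling v r) = r := by
  rw [axisScaling, LinearMap.transvection.det, LinearMap.smul_apply, innerₗ_apply_apply,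
    real_inner_self_eq_norm_sq, hv, smul_eq_mul]
  ring

theorem norm_axisScaling_sq {E : Type*} [NormedAddCommGroup E] [InnerProductSpace ℝ E]
    {v : E} (hv : ‖v‖ = 1) (r : ℝ) (x : E) :
    ‖axisScaling v r x‖ ^ 2 = ‖x‖ ^ 2 + (r ^ 2 - 1) * ⟪v, x⟫_ℝ ^ 2 := by
  have happly : axisScaling v r x = x + ((r - 1) * ⟪v, x⟫_ℝ) • v := rfl
  rw [happly, norm_add_sq_real, norm_smul, inner_smul_right, hv, real_inner_comm, mul_one,
    Real.norm_eq_abs, sq_abs]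
  ring

theorem inv_sqrt_one_sub_le_exp {t : ℝ} (ht : |t| ≤ 1 / 4) :
    (√(1 - 2 * t))⁻¹ ≤ Real.exp (t + 4 * t ^ 2) := by
  have ht' : |2 * t| ≤ 1 / 2 := by
    rw [abs_mul, abs_two]
    linarith
  have hpos : 0 < 1 - 2 * t := by linarith [(abs_le.1 ht).2]
  have hlog : |2 * t + Real.log (1 - 2 * t)| ≤ 8 * t ^ 2 := by
    have htaylor := Real.abs_log_sub_add_sum_range_le (ht'.trans_lt (by norm_num)) 1
    norm_num only [Finset.sum_range_one, zero_add, pow_one, div_one, Nat.cast_zero, sq_abs]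
      at htaylor
    refine htaylor.trans ?_
    rw [div_le_iff₀ (by linarith)]
    nlinarith [sq_nonneg t]
  rw [← Real.exp_log (Real.sqrt_pos.2 hpos), ← Real.exp_neg, Real.log_sqrt hpos.le,
    Real.exp_le_exp]
  linarith [(abs_le.1 hlog).1]

variable {d : ℕ} {v : EuclideanSpace ℝ (Fin d)} {t : ℝ}

theorem exp_inner_sq_le_inv_norm_axisScaling_pow (hv : ‖v‖ = 1) (ht : t < 1 / 2)
    (u : UnitSphere d) :
    Real.exp (t * (d * ⟪v, u⟫_ℝ ^ 2)) ≤ (‖axisScaling v √(1 - 2 * t) u‖ ^ d)⁻¹ := by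
  have hinner : ⟪v, u⟫_ℝ ^ 2 ≤ 1 := by
    have hcs := abs_real_inner_le_norm v u
    rw [hv, norm_eq_of_mem_sphere, mul_one] at hcs
    exact (sq_le_one_iff_abs_le_one _).2 hcs
  have hsq : ‖axisScaling v √(1 - 2 * t) u‖ ^ 2 = 1 - 2 * t * ⟪v, u⟫_ℝ ^ 2 := by
    rw [norm_axisScaling_sq hv, norm_eq_of_mem_sphere, Real.sq_sqrt (by linarith)]
    ring
  have hsqpos : 0 < ‖axisScaling v √(1 - 2 * t) u‖ ^ 2 := by
    rw [hsq]
    rcases le_total t 0 with h | h <;> nlinarith [sq_nonneg ⟪v, u⟫_ℝ]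
  have hpos : 0 < ‖axisScaling v √(1 - 2 * t) u‖ := by
    rwa [sq_pos_iff, ← (norm_nonneg _).lt_iff_ne'] at hsqpos
  have hle : ‖axisScaling v √(1 - 2 * t) u‖ ≤ Real.exp (-(t * ⟪v, u⟫_ℝ ^ 2)) := by
    refine le_of_sq_le_sq ?_ (Real.exp_pos _).le
    rw [hsq, ← Real.exp_nat_mul, Nat.cast_two]
    linarith [Real.add_one_le_exp (2 * -(t * ⟪v, u⟫_ℝ ^ 2))]
  rw [le_inv_comm₀ (Real.exp_pos _) (by positivity), ← Real.exp_neg]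
  calc ‖axisScaling v √(1 - 2 * t) u‖ ^ d ≤ Real.exp (-(t * ⟪v, u⟫_ℝ ^ 2)) ^ d := by gcongr
    _ = Real.exp (-(t * (d * ⟪v, u⟫_ℝ ^ 2))) := by
      rw [← Real.exp_nat_mul]
      ring_nf

theorem sphereUniform_integral_exp_inner_sq_le_inv_sqrt [NeZero d] (hv : ‖v‖ = 1)
    (ht : t < 1 / 2) :
    ∫ u : UnitSphere d, Real.exp (t * (d * ⟪v, u⟫_ℝ ^ 2)) ∂sphereUniform d ≤
      (√(1 - 2 * t))⁻¹ := by
  set r := √(1 - 2 * t)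
  have hr : 0 < r := Real.sqrt_pos.2 (by linarith)
  have hdet : LinearMap.det (axisScaling v r) ≠ 0 := by
    rw [det_axisScaling hv]
    exact hr.ne'
  rw [integral_eq_lintegral_of_nonneg_ae (Eventually.of_forall fun _ => (Real.exp_pos _).le)
    (Continuous.aestronglyMeasurable (by fun_prop))]
  refine ENNReal.toReal_le_of_le_ofReal (by positivity) ?_
  calc ∫⁻ u : UnitSphere d, ENNReal.ofReal (Real.exp (t * (d * ⟪v, u⟫_ℝ ^ 2))) ∂sphereUniform d
      ≤ ∫⁻ u : UnitSphere d, ENNReal.ofReal ((‖axisScaling v r u‖ ^ d)⁻¹) ∂sphereUniform d :=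
        lintegral_mono fun u =>
          ENNReal.ofReal_le_ofReal (exp_inner_sq_le_inv_norm_axisScaling_pow hv ht u)
    _ = ENNReal.ofReal |r⁻¹| * sphereUniform d Set.univ := by
        have hpolar := lintegral_toSphere_inv_norm_map_pow volume hdet
        rw [det_axisScaling hv, finrank_euclideanSpace_fin] at hpolar
        rw [sphereUniform, lintegral_smul_measure, hpolar, Measure.smul_apply, smul_eq_mul,
          smul_eq_mul, mul_left_comm]
    _ = ENNReal.ofReal r⁻¹ := by
        rw [measure_univ, mul_one, abs_of_pos (inv_pos.2 hr)]

theorem sphereUniform_integral_exp_centered_inner_sq_le [NeZero d] (hv : ‖v‖ = 1)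
    (ht : |t| ≤ 1 / 4) :
    ∫ u : UnitSphere d, Real.exp (t * (d * ⟪v, u⟫_ℝ ^ 2 - 1)) ∂sphereUniform d ≤
      Real.exp (4 * t ^ 2) := by
  calc ∫ u : UnitSphere d, Real.exp (t * (d * ⟪v, u⟫_ℝ ^ 2 - 1)) ∂sphereUniform d
      = Real.exp (-t) *
          ∫ u : UnitSphere d, Real.exp (t * (d * ⟪v, u⟫_ℝ ^ 2)) ∂sphereUniform d := by
        simp_rw [mul_sub, sub_eq_neg_add, Real.exp_add, mul_one]
        exact integral_const_mul _ _
    _ ≤ Real.exp (-t) * Real.exp (t + 4 * t ^ 2) := by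
        gcongr
        exact (sphereUniform_integral_exp_inner_sq_le_inv_sqrt hv
          (by linarith [(abs_le.1 ht).2])).trans (inv_sqrt_one_sub_le_exp ht)
    _ = Real.exp (4 * t ^ 2) := by
        rw [← Real.exp_add, neg_add_cancel_left]

end MomentGeneratingFunction

theorem measureReal_abs_ge_le_of_mgf_le {Ω : Type*} {mΩ : MeasurableSpace Ω} {μ : Measure Ω}
    [IsFiniteMeasure μ] {X : Ω → ℝ} {σ b s : ℝ} (hσ : 0 ≤ σ) (hb : 0 ≤ b) (hs : 0 ≤ s)
    (hsb : s ≤ b * σ) (hint : ∀ t, |t| ≤ b → Integrable (fun ω => Real.exp (t * X ω)) μ)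
    (hmgf : ∀ t, |t| ≤ b → ProbabilityTheory.mgf X μ t ≤ Real.exp (σ * t ^ 2 / 2)) :
    μ.real {ω | s ≤ |X ω|} ≤ 2 * Real.exp (-(s ^ 2 / (2 * σ))) := by
  set t := s / σ with htdef
  have ht : 0 ≤ t := by positivity
  have htb : |t| ≤ b := by
    rw [abs_of_nonneg ht]
    exact div_le_of_le_mul₀ hσ hb hsb
  have hexponent : -t * s + σ * t ^ 2 / 2 = -(s ^ 2 / (2 * σ)) := by
    rcases hσ.eq_or_lt with rfl | hσ
    · simp [htdef]
    · rw [htdef]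
      field
  have hupper : μ.real {ω | s ≤ X ω} ≤ Real.exp (-(s ^ 2 / (2 * σ))) := by
    refine (ProbabilityTheory.measure_ge_le_exp_mul_mgf s ht (hint t htb)).trans ?_
    rw [← hexponent, Real.exp_add]
    gcongr
    exact hmgf t htb
  have hlower : μ.real {ω | X ω ≤ -s} ≤ Real.exp (-(s ^ 2 / (2 * σ))) := by
    have htb' : |-t| ≤ b := by rwa [abs_neg]
    refine (ProbabilityTheory.measure_le_le_exp_mul_mgf (-s) (neg_nonpos.2 ht)
      (hint (-t) htb')).trans ?_
    rw [← hexponent, Real.exp_add, neg_neg, mul_neg, ← neg_mul, ← neg_sq t]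
    gcongr
    exact hmgf (-t) htb'
  calc μ.real {ω | s ≤ |X ω|} ≤ μ.real ({ω | s ≤ X ω} ∪ {ω | X ω ≤ -s}) :=
        measureReal_mono fun ω (hω : s ≤ |X ω|) => (le_abs.1 hω).imp_right le_neg_of_le_neg
    _ ≤ μ.real {ω | s ≤ X ω} + μ.real {ω | X ω ≤ -s} := measureReal_union_le _ _
    _ ≤ 2 * Real.exp (-(s ^ 2 / (2 * σ))) := by linarith

section QuadraticForm

variable {E : Type*} [NormedAddCommGroup E] [InnerProductSpace ℝ E] {Q : QuadraticForm ℝ E}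

theorem abs_quadraticForm_le_mul_norm_sq {m : ℝ} (hm : ∀ u : Metric.sphere (0 : E) 1, |Q u| ≤ m)
    (v : E) : |Q v| ≤ m * ‖v‖ ^ 2 := by
  rcases eq_or_ne v 0 with rfl | hv
  · simp
  have hpos : 0 < ‖v‖ := norm_pos_iff.2 hv
  have hunit := hm ⟨‖v‖⁻¹ • v, mem_sphere_zero_iff_norm.2 (norm_smul_inv_norm hv)⟩
  rwa [QuadraticMap.map_smul, smul_eq_mul, ← sq, inv_pow, abs_mul, abs_of_nonneg (by positivity),
    inv_mul_le_iff₀ (pow_pos hpos 2), mul_comm] at hunit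

theorem abs_quadraticForm_sub_le {m : ℝ} (hm : ∀ v, |Q v| ≤ m * ‖v‖ ^ 2) (x y : E) :
    |Q x - Q y| ≤ m * (‖x - y‖ * ‖x + y‖) := by
  rcases eq_or_ne x y with rfl | hsub
  · simp
  rcases eq_or_ne x (-y) with rfl | hadd
  · simp
  have hsub : 0 < ‖x - y‖ := norm_sub_pos_iff.2 hsub
  have hadd : 0 < ‖x + y‖ := norm_pos_iff.2 (mt eq_neg_of_add_eq_zero_left hadd)
  set t := ‖x + y‖ / ‖x - y‖ with ht
  have htpos : 0 < t := by positivity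
  have hid : Q (t • (x - y) + (x + y)) - Q (t • (x - y) - (x + y)) = 4 * t * (Q x - Q y) := by
    simp only [sub_eq_add_neg, QuadraticMap.map_add Q, QuadraticMap.map_neg Q,
      QuadraticMap.polar_smul_left, QuadraticMap.polar_add_left, QuadraticMap.polar_add_right,
      QuadraticMap.polar_neg_left, QuadraticMap.polar_neg_right, QuadraticMap.polar_self,
      QuadraticMap.polar_comm Q y x, smul_eq_mul, nsmul_eq_mul]
    ring
  have hpar : ‖t • (x - y) + (x + y)‖ ^ 2 + ‖t • (x - y) - (x + y)‖ ^ 2 = 4 * ‖x + y‖ ^ 2 := by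
    have h := parallelogram_law_with_norm ℝ (t • (x - y)) (x + y)
    rw [norm_smul, Real.norm_of_nonneg htpos.le, ht, div_mul_cancel₀ _ hsub.ne'] at h
    linear_combination h
  have hbound : 4 * t * |Q x - Q y| ≤ m * (4 * ‖x + y‖ ^ 2) := by
    calc 4 * t * |Q x - Q y|
        = |Q (t • (x - y) + (x + y)) - Q (t • (x - y) - (x + y))| := by
          rw [hid, abs_mul, abs_of_pos (mul_pos four_pos htpos)]
      _ ≤ |Q (t • (x - y) + (x + y))| + |Q (t • (x - y) - (x + y))| := abs_sub _ _
      _ ≤ m * (4 * ‖x + y‖ ^ 2) := by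
          rw [← hpar, mul_add]
          exact add_le_add (hm _) (hm _)
  have hmul : t * (‖x - y‖ * ‖x + y‖) = ‖x + y‖ ^ 2 := by
    rw [ht]
    field
  refine le_of_mul_le_mul_left ?_ htpos
  linear_combination hbound / 4 - m * hmul

theorem half_le_abs_quadraticForm_of_dist_le {u w : Metric.sphere (0 : E) 1}
    (hmax : ∀ v : Metric.sphere (0 : E) 1, |Q v| ≤ |Q w|) (huw : dist u w ≤ 1 / 4) :
    |Q w| / 2 ≤ |Q u| := by
  have hsum : ‖(u : E) + w‖ ≤ 2 := by
    refine (norm_add_le _ _).trans_eq ?_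
    rw [norm_eq_of_mem_sphere, norm_eq_of_mem_sphere]
    norm_num
  have hdiff : |Q u - Q w| ≤ |Q w| * (1 / 4 * 2) := by
    refine (abs_quadraticForm_sub_le (abs_quadraticForm_le_mul_norm_sq hmax) _ _).trans ?_
    gcongr
    rwa [← dist_eq_norm]
  linarith [abs_sub_abs_le_abs_sub (Q w) (Q u), abs_sub_comm (Q w) (Q u)]

end QuadraticForm

section UniformBound

variable {d : ℕ}

theorem sphereUniform_ball_one_fourth_ge [NeZero d] (w : UnitSphere d) :
    ENNReal.ofReal ((16 ^ d)⁻¹) ≤ sphereUniform d (Metric.ball w (1 / 4)) := by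
  have hbound : (Measure.toSphereBallBound (Module.finrank ℝ (EuclideanSpace ℝ (Fin d))) (1 / 4) :
      ENNReal) = d * ENNReal.ofReal ((16 ^ d)⁻¹) := by
    have hmin : min (Real.toNNReal (1 / 4)) 2 / 4 = Real.toNNReal (16⁻¹) := by
      ext
      norm_num
    rw [finrank_euclideanSpace_fin, Measure.toSphereBallBound,
      if_pos ⟨NeZero.ne d, by norm_num⟩, hmin, ← Real.toNNReal_pow (by norm_num), inv_pow]
    rfl
  rw [sphereUniform, Measure.smul_apply, smul_eq_mul, ← ENNReal.div_eq_inv_mul,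
    ENNReal.le_div_iff_mul_le (.inl <| Measure.measure_univ_ne_zero.2 (Measure.toSphere_ne_zero _))
      (.inl <| measure_ne_top _ _)]
  calc ENNReal.ofReal ((16 ^ d)⁻¹) * (volume : Measure _).toSphere Set.univ
      = d * ENNReal.ofReal ((16 ^ d)⁻¹) *
          volume (Metric.ball (0 : EuclideanSpace ℝ (Fin d)) 1) := by
        rw [Measure.toSphere_apply_univ, finrank_euclideanSpace_fin]
        ring
    _ ≤ (volume : Measure _).toSphere (Metric.ball w (1 / 4)) :=
        hbound ▸ Measure.toSphereBallBound_mul_measure_unitBall_le_toSphere_ball volume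
          (by norm_num) w

theorem measureReal_exists_abs_quadraticForm_gt_le [NeZero d] {Ω : Type*}
    {mΩ : MeasurableSpace Ω} {μ : Measure Ω} [IsFiniteMeasure μ]
    {Q : Ω → QuadraticForm ℝ (EuclideanSpace ℝ (Fin d))}
    (hmeas : Measurable fun p : Ω × UnitSphere d => Q p.1 p.2) (hcont : ∀ ω, Continuous (Q ω))
    {s δ : ℝ} (hδ : ∀ v : UnitSphere d, μ.real {ω | s ≤ |Q ω v|} ≤ δ) :
    μ.real {ω | ∃ v : UnitSphere d, 2 * s < |Q ω v|} ≤ 16 ^ d * δ := by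
  set A : Set (Ω × UnitSphere d) := {p | s ≤ |Q p.1 p.2|}
  have hA : MeasurableSet A :=
    measurableSet_le measurable_const (continuous_abs.measurable.comp hmeas)
  have hcap : ∀ ω ∈ {ω | ∃ v : UnitSphere d, 2 * s < |Q ω v|},
      ENNReal.ofReal ((16 ^ d)⁻¹) ≤ sphereUniform d (Prod.mk ω ⁻¹' A) := by
    rintro ω ⟨v, hv⟩
    obtain ⟨w, -, hw⟩ := isCompact_univ.exists_isMaxOn ⟨v, trivial⟩
      ((hcont ω).comp continuous_subtype_val).abs.continuousOn
    have hmax : ∀ v : UnitSphere d, |Q ω v| ≤ |Q ω w| := fun v => hw (Set.mem_univ v)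
    refine (sphereUniform_ball_one_fourth_ge w).trans (measure_mono fun u hu => ?_)
    have hhalf := half_le_abs_quadraticForm_of_dist_le hmax (Metric.mem_ball.1 hu).le
    change s ≤ |Q ω u|
    linarith [hmax v]
  have hprod : μ.prod (sphereUniform d) A ≤ ENNReal.ofReal δ := by
    rw [Measure.prod_apply_symm hA]
    calc ∫⁻ v, μ ((fun ω => (ω, v)) ⁻¹' A) ∂sphereUniform d
        ≤ ∫⁻ _, ENNReal.ofReal δ ∂sphereUniform d := by
          refine lintegral_mono fun v => ?_
          rw [← ofReal_measureReal]
          exact ENNReal.ofReal_le_ofReal (hδ v)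
      _ = ENNReal.ofReal δ := by simp
  have hmarkov : ENNReal.ofReal ((16 ^ d)⁻¹) * μ {ω | ∃ v : UnitSphere d, 2 * s < |Q ω v|} ≤
      ENNReal.ofReal δ := by
    calc ENNReal.ofReal ((16 ^ d)⁻¹) * μ {ω | ∃ v : UnitSphere d, 2 * s < |Q ω v|}
        ≤ ENNReal.ofReal ((16 ^ d)⁻¹) *
            μ {ω | ENNReal.ofReal ((16 ^ d)⁻¹) ≤ sphereUniform d (Prod.mk ω ⁻¹' A)} := by
          gcongr
          exact hcap _
      _ ≤ ∫⁻ ω, sphereUniform d (Prod.mk ω ⁻¹' A) ∂μ :=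
          mul_meas_ge_le_lintegral (measurable_measure_prodMk_left hA) _
      _ ≤ ENNReal.ofReal δ := by rwa [← Measure.prod_apply hA]
  have hδ0 : 0 ≤ δ :=
    measureReal_nonneg.trans (hδ (nonempty_of_isProbabilityMeasure (sphereUniform d)).some)
  rwa [← ofReal_measureReal, ← ENNReal.ofReal_mul (by positivity),
    ENNReal.ofReal_le_ofReal_iff hδ0, inv_mul_le_iff₀ (by positivity)] at hmarkov

variable {n : ℕ}

/-- The quadratic form of `d ∑ u_i u_iᵀ - n I`, which measures how far the frame `u` is from being
tight. -/
noncomputable def frameDeviation (u : Fin n → UnitSphere d) :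
    QuadraticForm ℝ (EuclideanSpace ℝ (Fin d)) :=
  ∑ i, ((d : ℝ) • QuadraticMap.linMulLin (innerₗ _ (u i : EuclideanSpace ℝ (Fin d)))
      (innerₗ _ (u i : EuclideanSpace ℝ (Fin d))) -
    LinearMap.BilinMap.toQuadraticMap (innerₗ _))

theorem frameDeviation_apply (u : Fin n → UnitSphere d) (v : EuclideanSpace ℝ (Fin d)) :
    frameDeviation u v = ∑ i, (d * ⟪v, u i⟫_ℝ ^ 2 - ‖v‖ ^ 2) := by
  simp only [frameDeviation, sum_apply, sub_apply, smul_apply,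
    QuadraticMap.linMulLin_apply, innerₗ_apply_apply, smul_eq_mul, ← sq,
    LinearMap.BilinMap.toQuadraticMap_apply, real_inner_self_eq_norm_sq, real_inner_comm]

theorem continuous_frameDeviation (u : Fin n → UnitSphere d) : Continuous (frameDeviation u) := by
  rw [funext (frameDeviation_apply u)]
  fun_prop

theorem measurable_frameDeviation :
    Measurable fun p : (Fin n → UnitSphere d) × UnitSphere d => frameDeviation p.1 p.2 := by
  simp only [frameDeviation_apply]
  fun_prop

theorem randomUnitVectors_mgf_frameDeviation_le [NeZero d] {v : EuclideanSpace ℝ (Fin d)}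
    (hv : ‖v‖ = 1) {t : ℝ} (ht : |t| ≤ 1 / 4) :
    ProbabilityTheory.mgf (fun u => frameDeviation u v) (randomUnitVectors d n) t ≤
      Real.exp (8 * n * t ^ 2 / 2) := by
  have hprod : ∀ u : Fin n → UnitSphere d, Real.exp (t * frameDeviation u v) =
      ∏ i, Real.exp (t * (d * ⟪v, u i⟫_ℝ ^ 2 - 1)) := fun u => by
    rw [frameDeviation_apply, hv, Finset.mul_sum, Real.exp_sum, one_pow]
  calc ∫ u, Real.exp (t * frameDeviation u v) ∂randomUnitVectors d n
      = (∫ x : UnitSphere d, Real.exp (t * (d * ⟪v, x⟫_ℝ ^ 2 - 1)) ∂sphereUniform d) ^ n := by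
        simp_rw [hprod]
        rw [randomUnitVectors, integral_fintype_prod_eq_pow
          (fun x : UnitSphere d => Real.exp (t * (d * ⟪v, x⟫_ℝ ^ 2 - 1))), Fintype.card_fin]
    _ ≤ Real.exp (4 * t ^ 2) ^ n := by
        exact pow_le_pow_left₀ (integral_nonneg fun _ => Real.exp_nonneg _)
          (sphereUniform_integral_exp_centered_inner_sq_le hv ht) n
    _ = Real.exp (8 * n * t ^ 2 / 2) := by
        rw [← Real.exp_nat_mul]
        ring_nf

theorem randomUnitVectors_abs_frameDeviation_ge_le [NeZero d] {v : EuclideanSpace ℝ (Fin d)}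
    (hv : ‖v‖ = 1) {x : ℝ} (hx₀ : 0 ≤ x) (hx₂ : x ≤ 2) :
    (randomUnitVectors d n).real {u | n * x ≤ |frameDeviation u v|} ≤
      2 * Real.exp (-(n * x ^ 2 / 16)) := by
  have hint : ∀ t : ℝ, Integrable (fun u => Real.exp (t * frameDeviation u v))
      (randomUnitVectors d n) := fun t => by
    simp only [frameDeviation_apply]
    exact integrable_of_continuous_of_compactSpace _ (by fun_prop)
  refine (measureReal_abs_ge_le_of_mgf_le (σ := 8 * n) (b := 1 / 4) (by positivity) (by norm_num)
    (by positivity) (by nlinarith) (fun t _ => hint t)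
    (fun t ht => randomUnitVectors_mgf_frameDeviation_le hv ht)).trans_eq ?_
  rcases eq_or_ne (n : ℝ) 0 with hn | hn
  · simp [hn]
  · field_simp [hn]
    norm_num

theorem randomUnitVectors_exists_abs_frameDeviation_gt_le [NeZero d] {x : ℝ} (hx₀ : 0 ≤ x)
    (hx₂ : x ≤ 2) :
    (randomUnitVectors d n).real {u | ∃ v : UnitSphere d, 2 * (n * x) < |frameDeviation u v|} ≤
      16 ^ d * (2 * Real.exp (-(n * x ^ 2 / 16))) :=
  measureReal_exists_abs_quadraticForm_gt_le measurable_frameDeviation continuous_frameDeviation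
    fun v => randomUnitVectors_abs_frameDeviation_ge_le (norm_eq_of_mem_sphere v) hx₀ hx₂

end UniformBound

section NearBalance

theorem posSemidef_sub_smul_one_iff {ι : Type*} [Fintype ι] [DecidableEq ι] {A : Matrix ι ι ℝ}
    (hA : A.IsHermitian) (c : ℝ) :
    (A - c • (1 : Matrix ι ι ℝ)).PosSemidef ↔ ∀ x : ι → ℝ, c * (x ⬝ᵥ x) ≤ x ⬝ᵥ A.mulVec x := by
  have hc : (c • (1 : Matrix ι ι ℝ)).IsHermitian := Matrix.isHermitian_one.smul (.all c)
  simp only [Matrix.posSemidef_iff_dotProduct_mulVec, hA.sub hc, true_and, star_trivial,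
    Matrix.sub_mulVec, dotProduct_sub, Matrix.smul_mulVec, Matrix.one_mulVec, dotProduct_smul,
    smul_eq_mul, sub_nonneg]

theorem posSemidef_smul_one_sub_iff {ι : Type*} [Fintype ι] [DecidableEq ι] {A : Matrix ι ι ℝ}
    (hA : A.IsHermitian) (c : ℝ) :
    (c • (1 : Matrix ι ι ℝ) - A).PosSemidef ↔ ∀ x : ι → ℝ, x ⬝ᵥ A.mulVec x ≤ c * (x ⬝ᵥ x) := by
  have hc : (c • (1 : Matrix ι ι ℝ)).IsHermitian := Matrix.isHermitian_one.smul (.all c)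
  simp only [Matrix.posSemidef_iff_dotProduct_mulVec, hc.sub hA, true_and, star_trivial,
    Matrix.sub_mulVec, dotProduct_sub, Matrix.smul_mulVec, Matrix.one_mulVec, dotProduct_smul,
    smul_eq_mul, sub_nonneg]

variable {d n : ℕ}

theorem frameMatrix_isHermitian (u : Fin n → EuclideanSpace ℝ (Fin d)) :
    (frameMatrix u).IsHermitian := by
  ext a b
  simp [frameMatrix, Matrix.sum_apply, Matrix.vecMulVec_apply, mul_comm]

theorem dotProduct_frameMatrix_mulVec (u : Fin n → EuclideanSpace ℝ (Fin d)) (x : Fin d → ℝ) :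
    x ⬝ᵥ (frameMatrix u).mulVec x = ∑ i, ⟪WithLp.toLp 2 x, u i⟫_ℝ ^ 2 := by
  simp only [frameMatrix, Matrix.sum_mulVec, dotProduct_sum, Matrix.vecMulVec_mulVec,
    op_smul_eq_smul, dotProduct_smul, smul_eq_mul, EuclideanSpace.inner_eq_star_dotProduct,
    star_trivial, sq, dotProduct_comm _ x]

theorem frameSize_coe_unitSphere (u : Fin n → UnitSphere d) :
    frameSize (fun i => (u i : EuclideanSpace ℝ (Fin d))) = n := by
  simp [frameSize]

theorem mul_dotProduct_frameMatrix_mulVec_coe (u : Fin n → UnitSphere d) (x : Fin d → ℝ) :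
    d * (x ⬝ᵥ (frameMatrix fun i => (u i : EuclideanSpace ℝ (Fin d))).mulVec x) =
      n * (x ⬝ᵥ x) + frameDeviation u (WithLp.toLp 2 x) := by
  rw [dotProduct_frameMatrix_mulVec, frameDeviation_apply, Finset.sum_sub_distrib, Finset.mul_sum,
    EuclideanSpace.real_norm_sq_eq]
  simp [dotProduct, sq]

theorem nearlyDoublyBalanced_of_abs_frameDeviation_le [NeZero d] [NeZero n] {ε : ℝ} (hε : 0 ≤ ε)
    {u : Fin n → UnitSphere d} (hu : ∀ v : UnitSphere d, |frameDeviation u v| ≤ n * ε) :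
    NearlyDoublyBalanced ε (fun i => (u i : EuclideanSpace ℝ (Fin d))) := by
  have hd : (0 : ℝ) < d := Nat.cast_pos.2 (NeZero.pos d)
  have hdev : ∀ x, |frameDeviation u (WithLp.toLp 2 x)| ≤ n * ε * (x ⬝ᵥ x) := fun x => by
    have hx := abs_quadraticForm_le_mul_norm_sq hu (WithLp.toLp 2 x)
    rwa [← real_inner_self_eq_norm_sq, EuclideanSpace.inner_eq_star_dotProduct] at hx
  have hnorm : frameNormMatrix (fun i => (u i : EuclideanSpace ℝ (Fin d))) = 1 := by
    simp [frameNormMatrix]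
  rw [NearlyDoublyBalanced, frameSize_coe_unitSphere, hnorm, div_self (NeZero.ne _), mul_one,
    mul_one, posSemidef_sub_smul_one_iff (frameMatrix_isHermitian _),
    posSemidef_smul_one_sub_iff (frameMatrix_isHermitian _),
    posSemidef_sub_smul_one_iff Matrix.isHermitian_one,
    posSemidef_smul_one_sub_iff Matrix.isHermitian_one]
  refine ⟨fun x => ?_, fun x => ?_, fun x => ?_, fun x => ?_⟩
  · refine le_of_mul_le_mul_left ?_ hd
    rw [mul_dotProduct_frameMatrix_mulVec_coe]
    field_simp
    linarith [(abs_le.1 (hdev x)).1]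
  · refine le_of_mul_le_mul_left ?_ hd
    rw [mul_dotProduct_frameMatrix_mulVec_coe]
    field_simp
    linarith [(abs_le.1 (hdev x)).2]
  all_goals
    rw [Matrix.one_mulVec]
    have hxx : 0 ≤ x ⬝ᵥ x := by simpa using dotProduct_self_star_nonneg x
    nlinarith

theorem randomUnitVectors_not_nearlyDoublyBalanced_le [NeZero d] [NeZero n] {ε : ℝ} (hε₀ : 0 ≤ ε)
    (hε₄ : ε ≤ 4) :
    (randomUnitVectors d n).real
        {u | ¬ NearlyDoublyBalanced ε (fun i => (u i : EuclideanSpace ℝ (Fin d)))} ≤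
      16 ^ d * (2 * Real.exp (-(n * ε ^ 2 / 64))) := by
  calc _ ≤ (randomUnitVectors d n).real
        {u | ∃ v : UnitSphere d, 2 * (n * (ε / 2)) < |frameDeviation u v|} := by
        refine measureReal_mono fun u hu => ?_
        contrapose! hu
        simp only [Set.mem_ofPred_eq, not_exists, not_lt] at hu
        simpa using nearlyDoublyBalanced_of_abs_frameDeviation_le hε₀ fun v =>
          (hu v).trans_eq (by ring)
    _ ≤ 16 ^ d * (2 * Real.exp (-(n * (ε / 2) ^ 2 / 16))) :=
        randomUnitVectors_exists_abs_frameDeviation_gt_le (by linarith) (by linarith)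
    _ = 16 ^ d * (2 * Real.exp (-(n * ε ^ 2 / 64))) := by
        ring_nf

end NearBalance

section Resampling

variable {ι X : Type*} [Fintype ι] [DecidableEq ι] [MeasurableSpace X]

theorem measurePreserving_update (μ : Measure X) [IsProbabilityMeasure μ] (l : ι) :
    MeasurePreserving (fun p : (ι → X) × X => Function.update p.1 l p.2)
      ((Measure.pi fun _ => μ).prod μ) (Measure.pi fun _ => μ) := by
  have hm : Measurable fun p : (ι → X) × X => Function.update p.1 l p.2 := by
    refine measurable_pi_lambda _ fun i => ?_
    rcases eq_or_ne i l with rfl | hi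
    · simpa using measurable_snd
    · simp only [Function.update_of_ne hi]
      exact (measurable_pi_apply i).comp measurable_fst
  refine ⟨hm, (Measure.pi_eq fun s hs => ?_).symm⟩
  have hpre : (fun p : (ι → X) × X => Function.update p.1 l p.2) ⁻¹' (Set.univ.pi s) =
      (Set.univ.pi (Function.update s l Set.univ)) ×ˢ s l := by
    ext p
    simp only [Set.mem_preimage, Set.mem_univ_pi, Set.mem_prod]
    rw [Function.forall_update_iff p.1 fun i y => y ∈ s i,
      Function.forall_update_iff s fun i t => p.1 i ∈ t]
    simp [and_comm]
  rw [Measure.map_apply hm (.univ_pi hs), hpre, Measure.prod_prod, Measure.pi_pi,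
    ← Finset.prod_erase_mul _ _ (Finset.mem_univ l),
    ← Finset.prod_erase_mul _ (fun i => μ (s i)) (Finset.mem_univ l), Function.update_self,
    measure_univ, mul_one]
  congr 1
  exact Finset.prod_congr rfl fun i hi => by
    rw [Function.update_of_ne (Finset.ne_of_mem_erase hi)]

theorem integral_mul_eq_integral_mul_integral_update {μ : Measure X} [IsProbabilityMeasure μ]
    (l : ι) {F G : (ι → X) → ℝ} (hFG : Integrable (fun u => G u * F u) (Measure.pi fun _ => μ))
    (hG : ∀ u x, G (Function.update u l x) = G u) :
    ∫ u, G u * F u ∂Measure.pi (fun _ => μ) =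
      ∫ u, G u * ∫ x, F (Function.update u l x) ∂μ ∂Measure.pi fun _ => μ := by
  have hmp := measurePreserving_update μ l
  have hint := (hmp.integrable_comp hFG.aestronglyMeasurable).2 hFG
  calc ∫ u, G u * F u ∂Measure.pi (fun _ => μ)
      = ∫ p : (ι → X) × X, G (Function.update p.1 l p.2) * F (Function.update p.1 l p.2)
          ∂(Measure.pi fun _ => μ).prod μ := by
        rw [← integral_map (f := fun u => G u * F u) hmp.measurable.aemeasurable
          (hmp.map_eq.symm ▸ hFG.aestronglyMeasurable), hmp.map_eq]
    _ = ∫ u, ∫ x, G (Function.update u l x) * F (Function.update u l x) ∂μ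
          ∂Measure.pi fun _ => μ := integral_prod _ hint
    _ = ∫ u, G u * ∫ x, F (Function.update u l x) ∂μ ∂Measure.pi fun _ => μ := by
        simp only [hG, integral_const_mul]

end Resampling

section SecondMoment

theorem integral_sum_sq_eq_sum_integral_mul {ι Ω : Type*} {mΩ : MeasurableSpace Ω}
    {μ : Measure Ω} {s : Finset ι} {f : ι → Ω → ℝ} (hf : ∀ i ∈ s, MemLp (f i) 2 μ) :
    ∫ ω, (∑ i ∈ s, f i ω) ^ 2 ∂μ = ∑ i ∈ s, ∑ j ∈ s, ∫ ω, f i ω * f j ω ∂μ := by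
  have hint : ∀ i ∈ s, ∀ j ∈ s, Integrable (fun ω => f i ω * f j ω) μ := fun i hi j hj =>
    (hf i hi).integrable_mul (hf j hj)
  simp_rw [sq, Finset.sum_mul_sum]
  rw [integral_finsetSum _ fun i hi => integrable_finsetSum _ (hint i hi)]
  exact Finset.sum_congr rfl fun i hi => integral_finsetSum _ (hint i hi)

theorem sum_le_card_univ_mul {ι : Type*} [Fintype ι] {s : Finset ι} {f : ι → ℝ} {c : ℝ}
    (hc : 0 ≤ c) (h : ∀ i ∈ s, f i ≤ c) : ∑ i ∈ s, f i ≤ Fintype.card ι * c := by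
  calc ∑ i ∈ s, f i ≤ s.card • c := Finset.sum_le_card_nsmul s f c h
    _ = s.card * c := nsmul_eq_mul _ _
    _ ≤ Fintype.card ι * c := by
      gcongr
      exact s.card_le_univ

end SecondMoment

section KernelMatrix

variable {ι X : Type*} [DecidableEq ι] {k : X → X → ℝ} {α : ℝ}

/-- The random matrix `k(u_i, u_j)` of a kernel `k` at a sample `u`, with its diagonal replaced by
zero. -/
def kernelMatrix (k : X → X → ℝ) (u : ι → X) : Matrix ι ι ℝ :=
  Matrix.of fun i j => if i = j then 0 else k (u i) (u j)

theorem kernelMatrix_isSymm (hk : ∀ x y, k x y = k y x) (u : ι → X) :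
    (kernelMatrix k u).IsSymm := by
  ext i j
  simp only [kernelMatrix, Matrix.transpose_apply, Matrix.of_apply, hk (u j), eq_comm]

/-- The centered summand `k(u_i, u_l) k(u_l, u_j) - α k(u_i, u_j)` of an off-diagonal entry of the
square of a kernel matrix. -/
def kernelFluctuation (k : X → X → ℝ) (α : ℝ) (u : ι → X) (i j l : ι) : ℝ :=
  k (u i) (u l) * k (u l) (u j) - α * k (u i) (u j)

variable [Fintype ι]

/-- The deviation of the square of a kernel matrix from the multiple of the kernel matrix that it
equals in the mean off the diagonal: such an entry has `card ι - 2` nonzero summands. -/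
def squareDeviation (k : X → X → ℝ) (α : ℝ) (u : ι → X) : Matrix ι ι ℝ :=
  kernelMatrix k u * kernelMatrix k u - ((Fintype.card ι - 2) * α) • kernelMatrix k u

theorem squareDeviation_apply_self (hk : ∀ x y, k x y = k y x) (u : ι → X) (i : ι) :
    squareDeviation k α u i i = ∑ l ∈ Finset.univ.erase i, k (u i) (u l) ^ 2 := by
  rw [squareDeviation, Matrix.sub_apply, Matrix.mul_apply, Matrix.smul_apply,
    ← Finset.add_sum_erase _ _ (Finset.mem_univ i)]
  simp only [kernelMatrix, Matrix.of_apply, if_true, mul_zero, smul_zero, zero_add, sub_zero]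
  refine Finset.sum_congr rfl fun l hl => ?_
  have hli := Finset.ne_of_mem_erase hl
  rw [if_neg hli.symm, if_neg hli, hk (u l), sq]

theorem squareDeviation_apply_of_ne (k : X → X → ℝ) (α : ℝ) (u : ι → X) {i j : ι} (hij : i ≠ j) :
    squareDeviation k α u i j =
      ∑ l ∈ (Finset.univ.erase i).erase j, kernelFluctuation k α u i j l := by
  have hj : j ∈ Finset.univ.erase i := Finset.mem_erase.2 ⟨hij.symm, Finset.mem_univ j⟩
  have hcard : (((Finset.univ.erase i).erase j).card : ℝ) = Fintype.card ι - 2 := by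
    rw [← Finset.card_univ, ← Finset.card_erase_add_one (Finset.mem_univ i),
      ← Finset.card_erase_add_one hj]
    push_cast
    ring
  rw [squareDeviation, Matrix.sub_apply, Matrix.mul_apply, Matrix.smul_apply,
    ← Finset.add_sum_erase _ _ (Finset.mem_univ i), ← Finset.add_sum_erase _ _ hj]
  simp only [kernelFluctuation, Finset.sum_sub_distrib, Finset.sum_const, nsmul_eq_mul, hcard,
    kernelMatrix, Matrix.of_apply, if_true, mul_zero, zero_mul, zero_add, if_neg hij, smul_eq_mul,
    mul_assoc]
  congr 1
  refine Finset.sum_congr rfl fun l hl => ?_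
  rw [if_neg (Finset.ne_of_mem_erase (Finset.mem_of_mem_erase hl)).symm,
    if_neg (Finset.ne_of_mem_erase hl)]

end KernelMatrix

/-- A bounded symmetric kernel whose integral operator is `α` times a projection; the bound is
normalized to one. -/
structure IsProjectionKernel {X : Type*} [MeasurableSpace X] (μ : Measure X) (k : X → X → ℝ)
    (α : ℝ) : Prop where
  measurable : Measurable (Function.uncurry k)
  symm : ∀ x y, k x y = k y x
  abs_le_one : ∀ x y, |k x y| ≤ 1
  nonneg : 0 ≤ α
  integral_mul : ∀ x y, ∫ z, k x z * k z y ∂μ = α * k x y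

namespace IsProjectionKernel

variable {ι X : Type*} [MeasurableSpace X] {μ : Measure X} {k : X → X → ℝ} {α : ℝ}

theorem sq_le_one (hk : IsProjectionKernel μ k α) (x y : X) : k x y ^ 2 ≤ 1 :=
  (sq_le_one_iff_abs_le_one _).2 (hk.abs_le_one x y)

theorem integrable_mul [IsFiniteMeasure μ] (hk : IsProjectionKernel μ k α) (x y : X) :
    Integrable (fun z => k x z * k z y) μ := by
  refine .of_bound ((hk.measurable.comp measurable_prodMk_left).mul
    (hk.measurable.comp measurable_prodMk_right)).aestronglyMeasurable 1 (.of_forall fun z => ?_)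
  rw [norm_mul]
  exact mul_le_one₀ (hk.abs_le_one x z) (norm_nonneg _) (hk.abs_le_one z y)

theorem integral_sq_le (hk : IsProjectionKernel μ k α) (x : X) : ∫ y, k x y ^ 2 ∂μ ≤ α := by
  calc ∫ y, k x y ^ 2 ∂μ = ∫ y, k x y * k y x ∂μ := by simp only [sq, hk.symm x]
    _ = α * k x x := hk.integral_mul x x
    _ ≤ α := mul_le_of_le_one_right hk.nonneg (le_of_abs_le (hk.abs_le_one x x))

variable [Fintype ι]

theorem memLp_top_apply (hk : IsProjectionKernel μ k α) (i j : ι) :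
    MemLp (fun u : ι → X => k (u i) (u j)) ⊤ (Measure.pi fun _ => μ) :=
  have hij : Measurable fun u : ι → X => (u i, u j) :=
    (measurable_pi_apply i).prodMk (measurable_pi_apply j)
  memLp_top_of_bound (hk.measurable.comp hij).aestronglyMeasurable 1
    (.of_forall fun u => hk.abs_le_one (u i) (u j))

theorem memLp_top_apply_sq (hk : IsProjectionKernel μ k α) (i j : ι) :
    MemLp (fun u : ι → X => k (u i) (u j) ^ 2) ⊤ (Measure.pi fun _ => μ) := by
  simp only [sq]
  exact (hk.memLp_top_apply i j).mul (hk.memLp_top_apply i j)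

theorem memLp_top_kernelFluctuation (hk : IsProjectionKernel μ k α) (i j l : ι) :
    MemLp (fun u : ι → X => kernelFluctuation k α u i j l) ⊤ (Measure.pi fun _ => μ) :=
  ((hk.memLp_top_apply l j).mul (hk.memLp_top_apply i l)).sub
    ((hk.memLp_top_apply i j).const_mul α)

theorem memLp_top_kernelMatrix [DecidableEq ι] (hk : IsProjectionKernel μ k α) (i j : ι) :
    MemLp (fun u : ι → X => kernelMatrix k u i j) ⊤ (Measure.pi fun _ => μ) := by
  rcases eq_or_ne i j with rfl | hij
  · simp [kernelMatrix]
  · simpa [kernelMatrix, hij] using hk.memLp_top_apply i j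

variable [IsProbabilityMeasure μ]

theorem integral_mul_sq_le [DecidableEq ι] (hk : IsProjectionKernel μ k α) {i l : ι} (hil : i ≠ l)
    {G : (ι → X) → ℝ} (hG₀ : 0 ≤ G) (hG : MemLp G ⊤ (Measure.pi fun _ => μ))
    (hGl : ∀ u x, G (Function.update u l x) = G u) :
    ∫ u, G u * k (u i) (u l) ^ 2 ∂Measure.pi (fun _ => μ) ≤
      (∫ u, G u ∂Measure.pi fun _ => μ) * α := by
  rw [integral_mul_eq_integral_mul_integral_update l
    (((hk.memLp_top_apply_sq i l).mul hG).integrable le_top) hGl, ← integral_mul_const]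
  simp only [Function.update_self, Function.update_of_ne hil]
  refine integral_mono_of_nonneg
    (.of_forall fun u => mul_nonneg (hG₀ u) (integral_nonneg fun _ => sq_nonneg _))
    ((hG.integrable le_top).mul_const α) (.of_forall fun u => ?_)
  exact mul_le_mul_of_nonneg_left (hk.integral_sq_le (u i)) (hG₀ u)

theorem integral_apply_sq_le (hk : IsProjectionKernel μ k α) {i j : ι} (hij : i ≠ j) :
    ∫ u : ι → X, k (u i) (u j) ^ 2 ∂Measure.pi (fun _ => μ) ≤ α := by
  classical
  simpa using hk.integral_mul_sq_le hij (G := 1) zero_le_one (memLp_const 1) fun _ _ => rfl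

theorem integral_apply_sq_mul_apply_sq_le (hk : IsProjectionKernel μ k α) {i j l : ι}
    (hij : i ≠ j) (hil : i ≠ l) (hjl : j ≠ l) :
    ∫ u : ι → X, k (u i) (u j) ^ 2 * k (u i) (u l) ^ 2 ∂Measure.pi (fun _ => μ) ≤ α ^ 2 := by
  classical
  calc ∫ u : ι → X, k (u i) (u j) ^ 2 * k (u i) (u l) ^ 2 ∂Measure.pi (fun _ => μ)
      ≤ (∫ u : ι → X, k (u i) (u j) ^ 2 ∂Measure.pi fun _ => μ) * α :=
        hk.integral_mul_sq_le hil (fun _ => sq_nonneg _) (hk.memLp_top_apply_sq i j) fun u x => by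
          rw [Function.update_of_ne hil, Function.update_of_ne hjl]
    _ ≤ α * α := mul_le_mul_of_nonneg_right (hk.integral_apply_sq_le hij) hk.nonneg
    _ = α ^ 2 := (sq α).symm

theorem integral_mul_kernelFluctuation_eq_zero [DecidableEq ι] (hk : IsProjectionKernel μ k α)
    {i j l : ι} (hil : i ≠ l) (hjl : j ≠ l) {G : (ι → X) → ℝ}
    (hG : MemLp G ⊤ (Measure.pi fun _ => μ)) (hGl : ∀ u x, G (Function.update u l x) = G u) :
    ∫ u, G u * kernelFluctuation k α u i j l ∂Measure.pi (fun _ => μ) = 0 := by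
  have hmean : ∀ u : ι → X, ∫ x, kernelFluctuation k α (Function.update u l x) i j l ∂μ = 0 :=
    fun u => by
      simp only [kernelFluctuation, Function.update_self, Function.update_of_ne hil,
        Function.update_of_ne hjl]
      rw [integral_sub (hk.integrable_mul _ _) (integrable_const _), hk.integral_mul]
      simp
  rw [integral_mul_eq_integral_mul_integral_update l
    (((hk.memLp_top_kernelFluctuation i j l).mul hG).integrable le_top) hGl]
  simp only [hmean, mul_zero, integral_zero]

theorem integral_kernelFluctuation_mul_eq_zero (hk : IsProjectionKernel μ k α) {i j l m : ι}
    (him : i ≠ m) (hjm : j ≠ m) (hlm : l ≠ m) :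
    ∫ u, kernelFluctuation k α u i j l * kernelFluctuation k α u i j m
      ∂Measure.pi (fun _ => μ) = 0 := by
  classical
  exact hk.integral_mul_kernelFluctuation_eq_zero him hjm (hk.memLp_top_kernelFluctuation i j l)
    fun u x => by
      simp only [kernelFluctuation, Function.update_of_ne him, Function.update_of_ne hjm,
        Function.update_of_ne hlm]

theorem integral_kernelFluctuation_sq_le (hk : IsProjectionKernel μ k α) {i j l : ι}
    (hij : i ≠ j) (hil : i ≠ l) (hjl : j ≠ l) :
    ∫ u, kernelFluctuation k α u i j l ^ 2 ∂Measure.pi (fun _ => μ) ≤ α ^ 2 := by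
  classical
  have hcross : ∫ u : ι → X, k (u i) (u j) * kernelFluctuation k α u i j l
      ∂Measure.pi (fun _ => μ) = 0 :=
    hk.integral_mul_kernelFluctuation_eq_zero hil hjl (hk.memLp_top_apply i j) fun u x => by
      rw [Function.update_of_ne hil, Function.update_of_ne hjl]
  have hint_cross : Integrable
      (fun u : ι → X => 2 * α * (k (u i) (u j) * kernelFluctuation k α u i j l))
      (Measure.pi fun _ => μ) :=
    (((hk.memLp_top_kernelFluctuation i j l).mul (hk.memLp_top_apply i j)).integrable
      le_top).const_mul _
  have hint_sq : Integrable (fun u : ι → X => k (u l) (u i) ^ 2 * k (u l) (u j) ^ 2)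
      (Measure.pi fun _ => μ) :=
    ((hk.memLp_top_apply_sq l j).mul (hk.memLp_top_apply_sq l i)).integrable le_top
  calc ∫ u, kernelFluctuation k α u i j l ^ 2 ∂Measure.pi (fun _ => μ)
      ≤ ∫ u : ι → X, (k (u l) (u i) ^ 2 * k (u l) (u j) ^ 2 -
          2 * α * (k (u i) (u j) * kernelFluctuation k α u i j l)) ∂Measure.pi (fun _ => μ) := by
        refine integral_mono_of_nonneg (.of_forall fun u => sq_nonneg _)
          (hint_sq.sub hint_cross) (.of_forall fun u => ?_)
        simp only [kernelFluctuation, hk.symm (u i) (u l)]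
        nlinarith [sq_nonneg (α * k (u i) (u j))]
    _ = ∫ u : ι → X, k (u l) (u i) ^ 2 * k (u l) (u j) ^ 2 ∂Measure.pi (fun _ => μ) := by
        rw [integral_sub hint_sq hint_cross, integral_const_mul, hcross, mul_zero, sub_zero]
    _ ≤ α ^ 2 := hk.integral_apply_sq_mul_apply_sq_le hil.symm hjl.symm hij

variable [DecidableEq ι]

theorem integrable_squareDeviation_sq (hk : IsProjectionKernel μ k α) (i j : ι) :
    Integrable (fun u : ι → X => squareDeviation k α u i j ^ 2) (Measure.pi fun _ => μ) := by
  have hentry : MemLp (fun u : ι → X => squareDeviation k α u i j) ⊤ (Measure.pi fun _ => μ) := by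
    simp only [squareDeviation, Matrix.sub_apply, Matrix.mul_apply, Matrix.smul_apply, smul_eq_mul]
    exact (memLp_finsetSum _ fun l _ =>
      (hk.memLp_top_kernelMatrix l j).mul (hk.memLp_top_kernelMatrix i l)).sub
      ((hk.memLp_top_kernelMatrix i j).const_mul _)
  exact (hentry.mono_exponent le_top).integrable_sq

theorem integral_squareDeviation_apply_self_sq_le (hk : IsProjectionKernel μ k α) (i : ι) :
    ∫ u, squareDeviation k α u i i ^ 2 ∂Measure.pi (fun _ => μ) ≤
      Fintype.card ι * (α + Fintype.card ι * α ^ 2) := by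
  have hα := hk.nonneg
  simp only [squareDeviation_apply_self hk.symm]
  rw [integral_sum_sq_eq_sum_integral_mul fun l _ =>
    (hk.memLp_top_apply_sq i l).mono_exponent le_top]
  refine sum_le_card_univ_mul (by positivity) fun l hl => ?_
  have hil := (Finset.ne_of_mem_erase hl).symm
  rw [← Finset.add_sum_erase _ _ hl]
  refine add_le_add ?_ (sum_le_card_univ_mul (sq_nonneg α) fun m hm => ?_)
  · refine le_trans (integral_mono_of_nonneg (.of_forall fun u => by positivity)
      ((hk.memLp_top_apply_sq i l).integrable le_top) (.of_forall fun u => ?_))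
      (hk.integral_apply_sq_le hil)
    exact mul_le_of_le_one_right (sq_nonneg _) (hk.sq_le_one _ _)
  · exact hk.integral_apply_sq_mul_apply_sq_le hil
      (Finset.ne_of_mem_erase (Finset.mem_of_mem_erase hm)).symm (Finset.ne_of_mem_erase hm).symm

theorem integral_squareDeviation_apply_sq_le_of_ne (hk : IsProjectionKernel μ k α) {i j : ι}
    (hij : i ≠ j) :
    ∫ u, squareDeviation k α u i j ^ 2 ∂Measure.pi (fun _ => μ) ≤ Fintype.card ι * α ^ 2 := by
  simp only [squareDeviation_apply_of_ne k α _ hij]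
  rw [integral_sum_sq_eq_sum_integral_mul fun l _ =>
    (hk.memLp_top_kernelFluctuation i j l).mono_exponent le_top]
  have hne : ∀ l ∈ (Finset.univ.erase i).erase j, i ≠ l ∧ j ≠ l := fun l hl =>
    ⟨(Finset.ne_of_mem_erase (Finset.mem_of_mem_erase hl)).symm, (Finset.ne_of_mem_erase hl).symm⟩
  refine sum_le_card_univ_mul (sq_nonneg α) fun l hl => ?_
  rw [Finset.sum_eq_single_of_mem l hl fun m hm hml =>
    hk.integral_kernelFluctuation_mul_eq_zero (hne m hm).1 (hne m hm).2 hml.symm]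
  simp only [← sq]
  exact hk.integral_kernelFluctuation_sq_le hij (hne l hl).1 (hne l hl).2

theorem integral_sum_squareDeviation_sq_le (hk : IsProjectionKernel μ k α) :
    ∫ u, ∑ i : ι, ∑ j, squareDeviation k α u i j ^ 2 ∂Measure.pi (fun _ => μ) ≤
      Fintype.card ι ^ 2 * α + 2 * Fintype.card ι ^ 3 * α ^ 2 := by
  have hα := hk.nonneg
  have hint := hk.integrable_squareDeviation_sq (ι := ι)
  rw [integral_finsetSum _ fun i _ => integrable_finsetSum _ fun j _ => hint i j]
  calc ∑ i : ι, ∫ u, ∑ j, squareDeviation k α u i j ^ 2 ∂Measure.pi (fun _ => μ)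
      ≤ Fintype.card ι * (Fintype.card ι * (α + Fintype.card ι * α ^ 2) +
          Fintype.card ι * (Fintype.card ι * α ^ 2)) := by
        refine sum_le_card_univ_mul (by positivity) fun i _ => ?_
        rw [integral_finsetSum _ fun j _ => hint i j,
          ← Finset.add_sum_erase _ _ (Finset.mem_univ i)]
        exact add_le_add (hk.integral_squareDeviation_apply_self_sq_le i)
          (sum_le_card_univ_mul (by positivity) fun j hj =>
            hk.integral_squareDeviation_apply_sq_le_of_ne (Finset.ne_of_mem_erase hj).symm)
    _ = Fintype.card ι ^ 2 * α + 2 * Fintype.card ι ^ 3 * α ^ 2 := by ring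

end IsProjectionKernel

section CenteredKernel

variable {d : ℕ}

/-- The squared inner product of two unit vectors, centered at its mean. -/
noncomputable def centeredKernel (d : ℕ) (x y : UnitSphere d) : ℝ :=
  ⟪(x : EuclideanSpace ℝ (Fin d)), y⟫_ℝ ^ 2 - 1 / d

theorem abs_centeredKernel_le_one (x y : UnitSphere d) : |centeredKernel d x y| ≤ 1 := by
  have hxy : ⟪(x : EuclideanSpace ℝ (Fin d)), y⟫_ℝ ^ 2 ≤ 1 := by
    rw [sq_le_one_iff_abs_le_one]
    simpa using abs_real_inner_le_norm (x : EuclideanSpace ℝ (Fin d)) y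
  have hd : 1 / (d : ℝ) ≤ 1 := by
    rw [one_div]
    exact Nat.cast_inv_le_one d
  have hd₀ : 0 ≤ 1 / (d : ℝ) := by positivity
  rw [centeredKernel, abs_le]
  constructor <;> linarith [sq_nonneg ⟪(x : EuclideanSpace ℝ (Fin d)), y⟫_ℝ]

theorem sphereUniform_integral_centeredKernel_mul [NeZero d] (x y : UnitSphere d) :
    ∫ z, centeredKernel d x z * centeredKernel d z y ∂sphereUniform d =
      2 / (d * (d + 2)) * centeredKernel d x y := by
  have hd : (d : ℝ) ≠ 0 := NeZero.ne _
  have hexpand : ∀ z : UnitSphere d, centeredKernel d x z * centeredKernel d z y =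
      ⟪(x : EuclideanSpace ℝ (Fin d)), z⟫_ℝ ^ 2 * ⟪(y : EuclideanSpace ℝ (Fin d)), z⟫_ℝ ^ 2 -
        (1 / d * (⟪(x : EuclideanSpace ℝ (Fin d)), z⟫_ℝ ^ 2 +
          ⟪(y : EuclideanSpace ℝ (Fin d)), z⟫_ℝ ^ 2) - (1 / d) ^ 2) := fun z => by
    rw [centeredKernel, centeredKernel, real_inner_comm (y : EuclideanSpace ℝ (Fin d))]
    ring
  simp only [hexpand]
  rw [integral_sub, integral_sub, integral_const_mul, integral_add,
    sphereUniform_integral_inner_sq_mul_inner_sq, sphereUniform_integral_inner_sq,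
    sphereUniform_integral_inner_sq, centeredKernel]
  · simp only [norm_eq_of_mem_sphere, integral_const, probReal_univ, smul_eq_mul]
    field_simp
    ring
  all_goals exact integrable_of_continuous_of_compactSpace _ (by fun_prop)

theorem isProjectionKernel_centeredKernel [NeZero d] :
    IsProjectionKernel (sphereUniform d) (centeredKernel d) (2 / (d * (d + 2))) where
  measurable := by
    simp only [Function.uncurry_def, centeredKernel]
    fun_prop
  symm x y := by rw [centeredKernel, real_inner_comm, centeredKernel]
  abs_le_one := abs_centeredKernel_le_one
  nonneg := by positivity
  integral_mul := sphereUniform_integral_centeredKernel_mul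

end CenteredKernel

section QuadraticForms

variable {ι : Type*} [Fintype ι]

theorem dotProduct_sq_le (a b : ι → ℝ) : (a ⬝ᵥ b) ^ 2 ≤ (a ⬝ᵥ a) * (b ⬝ᵥ b) := by
  simpa only [dotProduct, ← sq] using Finset.sum_mul_sq_le_sq_mul_sq Finset.univ a b

theorem mulVec_dotProduct_mulVec_le {κ : Type*} [Fintype κ] (A : Matrix κ ι ℝ) (a : ι → ℝ) :
    A.mulVec a ⬝ᵥ A.mulVec a ≤ (∑ i, ∑ j, A i j ^ 2) * (a ⬝ᵥ a) := by
  rw [dotProduct, Finset.sum_mul]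
  refine Finset.sum_le_sum fun i _ => ?_
  simpa only [Matrix.mulVec, dotProduct, ← sq] using dotProduct_sq_le (A i) a

theorem dotProduct_mulVec_sq_le (A : Matrix ι ι ℝ) (a : ι → ℝ) :
    (a ⬝ᵥ A.mulVec a) ^ 2 ≤ (∑ i, ∑ j, A i j ^ 2) * (a ⬝ᵥ a) ^ 2 := by
  have ha : 0 ≤ a ⬝ᵥ a := by simpa using dotProduct_self_star_nonneg a
  calc (a ⬝ᵥ A.mulVec a) ^ 2 ≤ (a ⬝ᵥ a) * (A.mulVec a ⬝ᵥ A.mulVec a) := dotProduct_sq_le _ _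
    _ ≤ (a ⬝ᵥ a) * ((∑ i, ∑ j, A i j ^ 2) * (a ⬝ᵥ a)) := by
      gcongr
      exact mulVec_dotProduct_mulVec_le A a
    _ = (∑ i, ∑ j, A i j ^ 2) * (a ⬝ᵥ a) ^ 2 := by ring

theorem dotProduct_mulVec_le_of_sq_near_smul {K : Matrix ι ι ℝ} (hK : K.IsSymm) {b c q : ℝ}
    (hcb : c ≤ b) (hb : 0 ≤ b) (hq : 0 ≤ q)
    (hKK : ∑ i, ∑ j, (K * K - c • K) i j ^ 2 ≤ q ^ 4) (a : ι → ℝ) :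
    a ⬝ᵥ K.mulVec a ≤ (b + q) * (a ⬝ᵥ a) := by
  have ha : 0 ≤ a ⬝ᵥ a := by simpa using dotProduct_self_star_nonneg a
  have hdev : a ⬝ᵥ (K * K - c • K).mulVec a ≤ q ^ 2 * (a ⬝ᵥ a) := by
    refine le_of_sq_le_sq ?_ (by positivity)
    calc (a ⬝ᵥ (K * K - c • K).mulVec a) ^ 2
        ≤ (∑ i, ∑ j, (K * K - c • K) i j ^ 2) * (a ⬝ᵥ a) ^ 2 := dotProduct_mulVec_sq_le _ a
      _ ≤ q ^ 4 * (a ⬝ᵥ a) ^ 2 := by gcongr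
      _ = (q ^ 2 * (a ⬝ᵥ a)) ^ 2 := by ring
  rw [Matrix.sub_mulVec, dotProduct_sub, ← Matrix.mulVec_mulVec, Matrix.dotProduct_mulVec,
    ← Matrix.mulVec_transpose, hK.eq, Matrix.smul_mulVec, dotProduct_smul, smul_eq_mul] at hdev
  have hcs := dotProduct_sq_le a (K.mulVec a)
  set κ := a ⬝ᵥ K.mulVec a
  set s := a ⬝ᵥ a
  by_contra! hlt
  have hκ : 0 < κ := lt_of_le_of_lt (by positivity) hlt
  have hquad : κ ^ 2 ≤ s * (q ^ 2 * s + b * κ) := by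
    refine hcs.trans (mul_le_mul_of_nonneg_left ?_ ha)
    linarith [mul_le_mul_of_nonneg_right hcb hκ.le]
  have hgap : 0 < κ - b * s - q * s := by linarith
  have hqs : 0 ≤ q * s := by positivity
  have hbs : 0 ≤ b * s := by positivity
  nlinarith [mul_pos hκ hgap, mul_nonneg hqs hgap.le, mul_nonneg hqs hbs]

end QuadraticForms

section SecondEigenvalue

variable {n : ℕ} {A : Matrix (Fin n) (Fin n) ℝ}

theorem exists_orthonormal_eigenvectors_secondEigenvalue (hA : A.IsHermitian) (hn : 1 < n) :
    ∃ (x y : Fin n → ℝ) (r : ℝ), x ⬝ᵥ x = 1 ∧ y ⬝ᵥ y = 1 ∧ x ⬝ᵥ y = 0 ∧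
      A.mulVec x = r • x ∧ A.mulVec y = secondEigenvalue hA • y ∧ secondEigenvalue hA ≤ r := by
  set e : Fin (Fintype.card (Fin n)) ≃ Fin n := Fintype.equivOfCardEq (Fintype.card_fin _)
  have h0 : 0 < Fintype.card (Fin n) := by simpa using hn.pos
  have h1 : 1 < Fintype.card (Fin n) := by simpa using hn
  have heig : ∀ k, hA.eigenvalues (e k) = hA.eigenvalues₀ k := fun k => by
    simp [Matrix.IsHermitian.eigenvalues, e]
  have hdot : ∀ k l, (hA.eigenvectorBasis k : Fin n → ℝ) ⬝ᵥ (hA.eigenvectorBasis l : Fin n → ℝ) =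
      if k = l then 1 else 0 := fun k l => by
    rw [← orthonormal_iff_ite.1 hA.eigenvectorBasis.orthonormal k l,
      EuclideanSpace.inner_eq_star_dotProduct, star_trivial, dotProduct_comm]
  refine ⟨hA.eigenvectorBasis (e ⟨0, h0⟩), hA.eigenvectorBasis (e ⟨1, h1⟩),
    hA.eigenvalues₀ ⟨0, h0⟩, ?_, ?_, ?_, ?_, ?_, ?_⟩
  · rw [hdot, if_pos rfl]
  · rw [hdot, if_pos rfl]
  · rw [hdot, if_neg (by simp)]
  · rw [hA.mulVec_eigenvectorBasis, heig]
  · rw [hA.mulVec_eigenvectorBasis, heig, secondEigenvalue, dif_pos hn]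
  · rw [secondEigenvalue, dif_pos hn]
    exact hA.eigenvalues₀_antitone (by simp)

-- Courant–Fischer: the span of the top two eigenvectors meets the hyperplane orthogonal to `w`.
theorem secondEigenvalue_le_of_dotProduct_eq_zero (hA : A.IsHermitian) {β : ℝ} (hβ : 0 ≤ β)
    (w : Fin n → ℝ) (h : ∀ a, w ⬝ᵥ a = 0 → a ⬝ᵥ A.mulVec a ≤ β * (a ⬝ᵥ a)) :
    secondEigenvalue hA ≤ β := by
  by_cases hn : 1 < n
  swap
  · rwa [secondEigenvalue, dif_neg hn]
  obtain ⟨x, y, r, hxx, hyy, hxy, hAx, hAy, hr⟩ :=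
    exists_orthonormal_eigenvectors_secondEigenvalue hA hn
  have hyx : y ⬝ᵥ x = 0 := by rw [dotProduct_comm, hxy]
  have hspan : ∀ s t : ℝ, s * (w ⬝ᵥ x) + t * (w ⬝ᵥ y) = 0 →
      r * s ^ 2 + secondEigenvalue hA * t ^ 2 ≤ β * (s ^ 2 + t ^ 2) := fun s t hst => by
    have hform := h (s • x + t • y) (by
      rwa [dotProduct_add, dotProduct_smul, dotProduct_smul, smul_eq_mul, smul_eq_mul])
    simp only [Matrix.mulVec_add, Matrix.mulVec_smul, hAx, hAy, add_dotProduct, dotProduct_add,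
      smul_dotProduct, dotProduct_smul, hxx, hyy, hxy, hyx, smul_eq_mul] at hform
    linarith
  rcases eq_or_ne (w ⬝ᵥ y) 0 with hwy | hwy
  · simpa using hspan 0 1 (by simp [hwy])
  · have hmem := hspan (w ⬝ᵥ y) (-(w ⬝ᵥ x)) (by ring)
    have hpos : 0 < (w ⬝ᵥ y) ^ 2 + (-(w ⬝ᵥ x)) ^ 2 := by positivity
    refine le_of_mul_le_mul_right ?_ hpos
    linarith [mul_le_mul_of_nonneg_right hr (sq_nonneg (w ⬝ᵥ y))]

end SecondEigenvalue
section SpectralGap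

variable {d n : ℕ}

theorem sqGram_eq_kernelMatrix_add (u : Fin n → UnitSphere d) :
    sqGram (fun i => (u i : EuclideanSpace ℝ (Fin d))) =
      kernelMatrix (centeredKernel d) u + (1 - 1 / d : ℝ) • 1 +
        (1 / d : ℝ) • Matrix.vecMulVec (fun _ => 1) (fun _ => 1) := by
  ext i j
  rcases eq_or_ne i j with rfl | hij
  · simp [sqGram, kernelMatrix, Matrix.vecMulVec_apply]
  · simp [sqGram, kernelMatrix, Matrix.vecMulVec_apply, centeredKernel, hij]

theorem secondEigenvalue_sqGram_le [NeZero d] (u : Fin n → UnitSphere d) {q : ℝ} (hq : 0 ≤ q)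
    (h : ∑ i, ∑ j, squareDeviation (centeredKernel d) (2 / (d * (d + 2))) u i j ^ 2 ≤ q ^ 4) :
    secondEigenvalue (sqGram_isHermitian fun i => (u i : EuclideanSpace ℝ (Fin d))) ≤
      1 + n * (2 / (d * (d + 2))) + q := by
  refine secondEigenvalue_le_of_dotProduct_eq_zero _ (by positivity) (fun _ => 1) fun a ha => ?_
  have hα : (0 : ℝ) ≤ 2 / (d * (d + 2)) := by positivity
  have hc : (Fintype.card (Fin n) - 2) * (2 / (d * (d + 2))) ≤ n * (2 / (d * (d + 2)) : ℝ) := by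
    rw [Fintype.card_fin]
    exact mul_le_mul_of_nonneg_right (by linarith) hα
  have hK := dotProduct_mulVec_le_of_sq_near_smul
    (kernelMatrix_isSymm isProjectionKernel_centeredKernel.symm u) hc (by positivity) hq h a
  have haa : 0 ≤ a ⬝ᵥ a := by simpa using dotProduct_self_star_nonneg a
  have hdaa : 0 ≤ 1 / (d : ℝ) * (a ⬝ᵥ a) := by positivity
  rw [sqGram_eq_kernelMatrix_add, Matrix.add_mulVec, Matrix.add_mulVec, dotProduct_add,
    dotProduct_add, Matrix.smul_mulVec, Matrix.smul_mulVec, Matrix.vecMulVec_mulVec, ha,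
    Matrix.one_mulVec, dotProduct_smul]
  simp only [MulOpposite.op_zero, zero_smul, smul_zero, dotProduct_zero, smul_eq_mul]
  linarith

theorem hasFrameSpectralGap_of_sum_squareDeviation_sq_le [NeZero d] {lam η : ℝ}
    (hdn : d ≤ η * n) (hlam : 2 * η + 2 / (d + 2) ≤ (1 - lam) ^ 2) {u : Fin n → UnitSphere d}
    (h : ∑ i, ∑ j, squareDeviation (centeredKernel d) (2 / (d * (d + 2))) u i j ^ 2 ≤
      (η * (n / d)) ^ 4) :
    HasFrameSpectralGap lam (fun i => (u i : EuclideanSpace ℝ (Fin d))) := by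
  have hd : (0 : ℝ) < d := Nat.cast_pos.2 (NeZero.pos d)
  have hn : (n : ℝ) ≠ 0 := fun hn => hd.not_ge (by simpa only [hn, mul_zero] using hdn)
  have hnd : 1 ≤ η * (n / d) := by rwa [← mul_div_assoc, one_le_div hd]
  rw [HasFrameSpectralGap, frameSize_coe_unitSphere]
  calc secondEigenvalue (sqGram_isHermitian fun i => (u i : EuclideanSpace ℝ (Fin d)))
      ≤ 1 + n * (2 / (d * (d + 2))) + η * (n / d) :=
        secondEigenvalue_sqGram_le u (zero_le_one.trans hnd) h
    _ = 1 + 2 / (d + 2) * (n / d) + η * (n / d) := by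
      congr 2
      field_simp
    _ ≤ (2 * η + 2 / (d + 2)) * (n / d) := by linarith
    _ ≤ (1 - lam) ^ 2 * (n / d) := by gcongr
    _ = (1 - lam) ^ 2 * ((n : ℝ) ^ 2 / (d * n)) := by
      congr 1
      field_simp

theorem randomUnitVectors_integral_sum_squareDeviation_sq_le [NeZero d] (hdn : d ≤ n) :
    ∫ u, ∑ i, ∑ j, squareDeviation (centeredKernel d) (2 / (d * (d + 2))) u i j ^ 2
      ∂randomUnitVectors d n ≤ 10 * n ^ 3 / (d : ℝ) ^ 3 := by
  have hd : (1 : ℝ) ≤ d := Nat.one_le_cast.2 NeZero.one_le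
  have hdn' : (d : ℝ) ≤ n := Nat.cast_le.2 hdn
  have hα : 2 / (d * (d + 2)) ≤ 2 / (d : ℝ) ^ 2 := by
    gcongr
    nlinarith
  calc ∫ u, ∑ i, ∑ j, squareDeviation (centeredKernel d) (2 / (d * (d + 2))) u i j ^ 2
        ∂randomUnitVectors d n
      ≤ n ^ 2 * (2 / (d * (d + 2))) + 2 * n ^ 3 * (2 / (d * (d + 2))) ^ 2 := by
        simpa [randomUnitVectors] using
          isProjectionKernel_centeredKernel.integral_sum_squareDeviation_sq_le
            (μ := sphereUniform d) (ι := Fin n)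
    _ ≤ n ^ 2 * (2 / (d : ℝ) ^ 2) + 2 * n ^ 3 * (2 / (d : ℝ) ^ 2) ^ 2 := by gcongr
    _ = (2 * n ^ 2 * d + 8 * n ^ 3 / d) / (d : ℝ) ^ 3 := by
      field_simp
      ring
    _ ≤ (2 * n ^ 2 * n + 8 * n ^ 3) / (d : ℝ) ^ 3 := by
      gcongr
      exact div_le_self (by positivity) hd
    _ = 10 * n ^ 3 / (d : ℝ) ^ 3 := by ring

theorem randomUnitVectors_not_hasFrameSpectralGap_le [NeZero d] {lam η : ℝ} (hη : 0 < η)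
    (hdn : d ≤ n) (hdηn : d ≤ η * n) (hlam : 2 * η + 2 / (d + 2) ≤ (1 - lam) ^ 2) :
    (randomUnitVectors d n).real
      {u | ¬ HasFrameSpectralGap lam (fun i => (u i : EuclideanSpace ℝ (Fin d)))} ≤
        10 * d / (η ^ 4 * n) := by
  have : NeZero n := ⟨((NeZero.pos d).trans_le hdn).ne'⟩
  have hd : (0 : ℝ) < d := Nat.cast_pos.2 (NeZero.pos d)
  have hn : (0 : ℝ) < n := Nat.cast_pos.2 (NeZero.pos n)
  have hmarkov := mul_meas_ge_le_integral_of_nonneg (μ := randomUnitVectors d n)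
    (f := fun u => ∑ i, ∑ j, squareDeviation (centeredKernel d) (2 / (d * (d + 2))) u i j ^ 2)
    (.of_forall fun u => Finset.sum_nonneg fun i _ => Finset.sum_nonneg fun j _ => sq_nonneg _)
    (integrable_finsetSum _ fun i _ => integrable_finsetSum _ fun j _ =>
      isProjectionKernel_centeredKernel.integrable_squareDeviation_sq i j) ((η * (n / d)) ^ 4)
  calc (randomUnitVectors d n).real
        {u | ¬ HasFrameSpectralGap lam (fun i => (u i : EuclideanSpace ℝ (Fin d)))}
      ≤ (randomUnitVectors d n).real {u | (η * (n / d)) ^ 4 ≤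
          ∑ i, ∑ j, squareDeviation (centeredKernel d) (2 / (d * (d + 2))) u i j ^ 2} :=
        measureReal_mono fun u hu => le_of_not_ge fun h =>
          hu (hasFrameSpectralGap_of_sum_squareDeviation_sq_le hdηn hlam h)
    _ ≤ 10 * n ^ 3 / (d : ℝ) ^ 3 / (η * (n / d)) ^ 4 := by
      rw [le_div_iff₀' (by positivity)]
      exact hmarkov.trans (randomUnitVectors_integral_sum_squareDeviation_sq_le hdn)
    _ = 10 * d / (η ^ 4 * n) := by field_simp

end SpectralGap

section GoodFrames

theorem one_sub_add_le_measureReal_goodFrames (d n : ℕ) [NeZero d] (ε lam : ℝ) :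
    1 - ((randomUnitVectors d n).real
          {u | ¬ NearlyDoublyBalanced ε (fun i => (u i : EuclideanSpace ℝ (Fin d)))} +
        (randomUnitVectors d n).real
          {u | ¬ HasFrameSpectralGap lam (fun i => (u i : EuclideanSpace ℝ (Fin d)))}) ≤
      (randomUnitVectors d n).real (goodFrames d n ε lam) := by
  have hcover : Set.univ ⊆ goodFrames d n ε lam ∪
      ({u | ¬ NearlyDoublyBalanced ε (fun i => (u i : EuclideanSpace ℝ (Fin d)))} ∪
        {u | ¬ HasFrameSpectralGap lam (fun i => (u i : EuclideanSpace ℝ (Fin d)))}) := by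
    intro u _
    simp only [goodFrames, Set.mem_union, Set.mem_ofPred_eq]
    tauto
  rw [sub_le_iff_le_add]
  exact probReal_univ.symm.trans_le <| (measureReal_mono hcover).trans <|
    (measureReal_union_le _ _).trans (add_le_add_right (measureReal_union_le _ _) _)

theorem randomUnitVectors_not_nearlyDoublyBalanced_le_of_mul_le {d n : ℕ} [NeZero d] [NeZero n]
    {ε K : ℝ} (hε₀ : 0 ≤ ε) (hε₄ : ε ≤ 4) (hn : K * d ≤ n * ε ^ 2)
    (hK : 16 * Real.exp (-(K / 64)) ≤ 1) :
    (randomUnitVectors d n).real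
      {u | ¬ NearlyDoublyBalanced ε (fun i => (u i : EuclideanSpace ℝ (Fin d)))} ≤
        2 * (16 * Real.exp (-(K / 64))) := by
  calc (randomUnitVectors d n).real
        {u | ¬ NearlyDoublyBalanced ε (fun i => (u i : EuclideanSpace ℝ (Fin d)))}
      ≤ 16 ^ d * (2 * Real.exp (-(n * ε ^ 2 / 64))) :=
        randomUnitVectors_not_nearlyDoublyBalanced_le hε₀ hε₄
    _ ≤ 16 ^ d * (2 * Real.exp (-(K * d / 64))) := by gcongr
    _ = 2 * (16 * Real.exp (-(K / 64))) ^ d := by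
      rw [mul_pow, ← Real.exp_nat_mul]
      ring_nf
    _ ≤ 2 * (16 * Real.exp (-(K / 64))) := by
      gcongr
      exact pow_le_of_le_one (by positivity) hK (NeZero.ne d)

theorem exists_forall_le_measureReal_goodFrames {p η : ℝ} (hp : p < 1) (hη : 0 < η) :
    ∃ K : ℝ, 1 ≤ K ∧ ∀ (d n : ℕ) [NeZero d] (ε lam : ℝ), 0 ≤ ε → ε ≤ 1 → K * d ≤ n * ε ^ 2 →
      2 * η + 2 / (d + 2) ≤ (1 - lam) ^ 2 →
        p ≤ (randomUnitVectors d n).real (goodFrames d n ε lam) := by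
  have hp' : 0 < 1 - p := sub_pos.2 hp
  have hexp : Tendsto (fun K : ℝ => 16 * Real.exp (-(K / 64))) atTop (𝓝 0) := by
    simpa using (Real.tendsto_exp_neg_atTop_nhds_zero.comp
      (tendsto_id.atTop_div_const (by norm_num : (0 : ℝ) < 64))).const_mul 16
  obtain ⟨K, hK, hKη, hKgap, hK₁, hKbal⟩ :=
    ((eventually_ge_atTop 1).and <| (eventually_ge_atTop η⁻¹).and <|
      (eventually_ge_atTop (20 / (η ^ 4 * (1 - p)))).and <|
      (hexp.eventually_le_const one_pos).and <|
      hexp.eventually_le_const (div_pos hp' four_pos)).exists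
  refine ⟨K, hK, fun d n _ ε lam hε₀ hε₁ hn hlam => ?_⟩
  have hd : (0 : ℝ) < d := Nat.cast_pos.2 (NeZero.pos d)
  have hKn : K * d ≤ n := hn.trans (mul_le_of_le_one_right n.cast_nonneg (pow_le_one₀ hε₀ hε₁))
  have hdn : (d : ℝ) ≤ n := (le_mul_of_one_le_left hd.le hK).trans hKn
  have hdηn : d ≤ η * n := (inv_mul_le_iff₀ hη).1 <|
    (mul_le_mul_of_nonneg_right hKη hd.le).trans hKn
  have hn₀ : NeZero n := ⟨by rintro rfl; exact hd.not_ge (by simpa using hdn)⟩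
  have hbal :=
    randomUnitVectors_not_nearlyDoublyBalanced_le_of_mul_le hε₀ (by linarith) hn hK₁
  have hgap : (randomUnitVectors d n).real
      {u | ¬ HasFrameSpectralGap lam (fun i => (u i : EuclideanSpace ℝ (Fin d)))} ≤
        (1 - p) / 2 := by
    refine (randomUnitVectors_not_hasFrameSpectralGap_le hη (Nat.cast_le.1 hdn) hdηn hlam).trans ?_
    have hKgap' := (mul_le_mul_of_nonneg_right hKgap hd.le).trans hKn
    have hn' : (0 : ℝ) < n := hd.trans_le hdn
    rw [div_mul_eq_mul_div, div_le_iff₀ (by positivity)] at hKgap'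
    rw [div_le_div_iff₀ (by positivity) two_pos]
    linarith
  linarith [one_sub_add_le_measureReal_goodFrames d n ε lam]

end GoodFrames

section Asymptotics

variable {f : ℕ → ℝ}

theorem tendsto_sqrt_div_mul_log (hf : ∀ d : ℕ, (d : ℝ) ≤ f d)
    (hlog : (fun d : ℕ => d * Real.log d ^ 2) =o[atTop] f) :
    Tendsto (fun d : ℕ => √(d / f d) * Real.log d) atTop (𝓝 0) := by
  have h := hlog.tendsto_div_nhds_zero.sqrt
  rw [Real.sqrt_zero] at h
  refine h.congr fun d => ?_
  have hd : 0 ≤ d / f d := div_nonneg d.cast_nonneg (d.cast_nonneg.trans (hf d))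
  rw [mul_div_right_comm, Real.sqrt_mul hd, Real.sqrt_sq (Real.log_natCast_nonneg d)]

theorem exists_forall_le_measureReal_goodFrames_sqrt_div (hf : ∀ d : ℕ, (d : ℝ) ≤ f d) {p lam : ℝ}
    (hp : p < 1) (hlam : lam < 1) :
    ∃ C : ℝ, 0 < C ∧ ∃ D : ℕ, ∀ d : ℕ, D ≤ d → ∀ n : ℕ, C * f d ≤ n →
      p ≤ (randomUnitVectors d n).real (goodFrames d n (√(d / f d)) lam) := by
  have hgap : 0 < (1 - lam) ^ 2 / 4 := by
    have := sub_pos.2 hlam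
    positivity
  obtain ⟨K, hK, hgood⟩ := exists_forall_le_measureReal_goodFrames hp hgap
  have hD : Tendsto (fun d : ℕ => 2 / ((d : ℝ) + 2)) atTop (𝓝 0) :=
    tendsto_const_nhds.div_atTop (tendsto_atTop_add_const_right _ 2 tendsto_natCast_atTop_atTop)
  obtain ⟨D, hD⟩ := eventually_atTop.1 <|
    (eventually_gt_atTop 0).and (hD.eventually_le_const (by linarith : 0 < (1 - lam) ^ 2 / 2))
  refine ⟨K, by linarith, D, fun d hDd n hn => ?_⟩
  obtain ⟨hd, hdlam⟩ := hD d hDd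
  have : NeZero d := ⟨hd.ne'⟩
  have hfd : 0 < f d := (Nat.cast_pos.2 hd).trans_le (hf d)
  refine hgood d n _ lam (Real.sqrt_nonneg _) ?_ ?_ (by linarith)
  · rw [Real.sqrt_le_one, div_le_one hfd]
    exact hf d
  · rw [Real.sq_sqrt (by positivity), mul_div_left_comm, mul_comm]
    gcongr
    rwa [le_div_iff₀ hfd]

theorem exists_forall_exists_le_measureReal_goodFrames_tenth (hf : ∀ d : ℕ, (d : ℝ) ≤ f d)
    (hlog : (fun d : ℕ => d * Real.log d ^ 2) =O[atTop] f) {p c : ℝ} (hp : p < 1) (hc : 0 < c) :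
    ∃ C : ℝ, 0 < C ∧ ∀ d : ℕ, 1 ≤ d → ∀ n : ℕ, C * f d ≤ n →
      ∃ ε : ℝ, 0 ≤ ε ∧ ε * Real.log d ≤ c ∧
        p ≤ (randomUnitVectors d n).real (goodFrames d n ε (1 / 10)) := by
  obtain ⟨K, hK, hgood⟩ :=
    exists_forall_le_measureReal_goodFrames hp (by norm_num : (0 : ℝ) < 1 / 20)
  obtain ⟨M, hM, hlogM⟩ := Asymptotics.bound_of_isBigO_nat_atTop hlog
  refine ⟨max K (K * M / c ^ 2), by positivity, fun d hd n hn => ?_⟩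
  have : NeZero d := ⟨Nat.ne_of_gt hd⟩
  have hd₁ : (1 : ℝ) ≤ d := Nat.one_le_cast.2 hd
  have hfd : 0 < f d := (zero_lt_one.trans_le hd₁).trans_le (hf d)
  rw [max_mul_of_nonneg _ _ hfd.le, max_le_iff] at hn
  have hKn : K * d ≤ n := (mul_le_mul_of_nonneg_left (hf d) (by linarith)).trans hn.1
  have hn₀ : (0 : ℝ) < n := lt_of_lt_of_le (by positivity) hKn
  have hlogd : d * Real.log d ^ 2 ≤ M * f d := by
    have h := hlogM hfd.ne'
    rwa [Real.norm_of_nonneg (by positivity), Real.norm_of_nonneg hfd.le] at h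
  refine ⟨√(K * d / n), Real.sqrt_nonneg _, le_of_sq_le_sq ?_ hc.le,
    hgood d n _ _ (Real.sqrt_nonneg _) ?_ ?_ ?_⟩
  · calc (√(K * d / n) * Real.log d) ^ 2 = K * (d * Real.log d ^ 2) / n := by
          rw [mul_pow, Real.sq_sqrt (by positivity)]
          ring
      _ ≤ K * (M * f d) / n := by gcongr
      _ = K * M / c ^ 2 * f d * c ^ 2 / n := by field_simp
      _ ≤ n * c ^ 2 / n := by gcongr; exact hn.2
      _ = c ^ 2 := mul_div_cancel_left₀ _ hn₀.ne'
  · rwa [Real.sqrt_le_one, div_le_one hn₀]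
  · rw [Real.sq_sqrt (by positivity), mul_div_cancel₀ _ hn₀.ne']
  · have hd₃ : 2 / ((d : ℝ) + 2) ≤ 2 / (1 + 2) := by gcongr
    norm_num at hd₃ ⊢
    linarith

end Asymptotics

theorem natCast_le_rpow_of_one_le (d : ℕ) {s : ℝ} (hs : 1 ≤ s) : (d : ℝ) ≤ (d : ℝ) ^ s := by
  rcases d.eq_zero_or_pos with rfl | hd
  · simpa using Real.rpow_nonneg le_rfl s
  · exact Real.self_le_rpow_of_one_le (Nat.one_le_cast.2 hd) hs

theorem isLittleO_natCast_mul_log_sq_rpow {s : ℝ} (hs : 1 < s) :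
    (fun d : ℕ => d * Real.log d ^ 2) =o[atTop] fun d : ℕ => (d : ℝ) ^ s := by
  have h : (fun x : ℝ => x * Real.log x ^ 2) =o[atTop] fun x : ℝ => x ^ s := by
    refine ((Asymptotics.isBigO_refl (fun x : ℝ => x) atTop).mul_isLittleO
      (isLittleO_log_rpow_rpow_atTop 2 (sub_pos.2 hs))).congr' ?_ ?_
    · exact .of_forall fun x => by simp
    · filter_upwards [eventually_gt_atTop 0] with x hx
      rw [← Real.rpow_one_add' hx.le (by linarith), add_sub_cancel]
  exact h.comp_tendsto tendsto_natCast_atTop_atTop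

theorem theoremt_general {f : ℕ → ℝ} (hf : ∀ d : ℕ, (d : ℝ) ≤ f d)
    (hlog : (fun d : ℕ => d * Real.log d ^ 2) =o[atTop] f) {p : ℝ} (hp : p < 1) :
    (∃ ε : ℕ → ℝ, (∀ d, 0 ≤ ε d) ∧ Tendsto (fun d : ℕ => ε d * Real.log d) atTop (𝓝 0) ∧
      ∀ lam < 1, ∃ C : ℝ, 0 < C ∧ ∃ D : ℕ, ∀ d : ℕ, D ≤ d → ∀ n : ℕ, C * f d ≤ n →
        p ≤ (randomUnitVectors d n).real (goodFrames d n (ε d) lam)) ∧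
    (∃ lam : ℝ, 0 < lam ∧ lam < 1 ∧ ∀ c : ℝ, 0 < c →
      ∃ C : ℝ, 0 < C ∧ ∀ d : ℕ, 1 ≤ d → ∀ n : ℕ, C * f d ≤ n →
        ∃ ε : ℝ, 0 ≤ ε ∧ ε * Real.log d ≤ c ∧
          p ≤ (randomUnitVectors d n).real (goodFrames d n ε lam)) :=
  ⟨⟨fun d => √(d / f d), fun _ => Real.sqrt_nonneg _, tendsto_sqrt_div_mul_log hf hlog,
    fun _ => exists_forall_le_measureReal_goodFrames_sqrt_div hf hp⟩,
  1 / 10, by norm_num, by norm_num, fun _ =>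
    exists_forall_exists_le_measureReal_goodFrames_tenth hf hlog.isBigO hp⟩

theorem theoremt :
    (∃ ε : ℕ → ℝ, (∀ d, 0 ≤ ε d) ∧
      Tendsto (fun d : ℕ => ε d * Real.log (d : ℝ)) atTop (𝓝 0) ∧
      ∀ lam : ℝ, 0 ≤ lam → lam < 1 →
        ∃ C : ℝ, 0 < C ∧ ∃ D : ℕ, ∀ d : ℕ, D ≤ d → ∀ n : ℕ,
          C * (d : ℝ) ^ ((4 : ℝ) / 3) ≤ (n : ℝ) →
            (0.99 : ℝ) ≤ (randomUnitVectors d n).real (goodFrames d n (ε d) lam)) ∧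
    (∃ lam : ℝ, 0 < lam ∧ lam < 1 ∧ ∀ c : ℝ, 0 < c →
      ∃ C : ℝ, 0 < C ∧ ∀ d : ℕ, 1 ≤ d → ∀ n : ℕ,
        C * (d : ℝ) ^ ((4 : ℝ) / 3) ≤ (n : ℝ) →
          ∃ ε : ℝ, 0 ≤ ε ∧ ε * Real.log (d : ℝ) ≤ c ∧
            (0.99 : ℝ) ≤ (randomUnitVectors d n).real (goodFrames d n ε lam)) :=
  have ⟨⟨ε, hε, hlim, hgood⟩, hgap⟩ := theoremt_general
    (fun d => natCast_le_rpow_of_one_le d (by norm_num : (1 : ℝ) ≤ 4 / 3))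
    (isLittleO_natCast_mul_log_sq_rpow (by norm_num)) (by norm_num : (0.99 : ℝ) < 1)
  ⟨⟨ε, hε, hlim, fun lam _ => hgood lam⟩, hgap⟩
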